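/- Let $\mathfrak n$ be a finite-dimensional real Lie algebra, $d\ge 1$, with a basis $Z_1,\dots,Z_p,Y_1,\dots,Y_d,X_1,\dots,X_d$ such that $[\mathfrak n,\mathfrak n]$ is contained in the center $\mathfrak z$ of $\mathfrak n$, $\mathfrak z=\operatorname{span}\{Z_1,\dots,Z_p\}$, $[Y_i,Y_j]=[X_i,X_j]=0$ for all $i,j$, and some linear functional $\ell$ on $\mathfrak n$ has stabilizer $\{W:\ell[W,V]=0\ \forall V\}$ equal to $\mathfrak z$. Let $N=\exp\mathfrak n$ be the connected simply connected Lie group of $\mathfrak n$, with Haar measure $dz\,dy\,dx$ in the coordinates $\exp(\sum z_kZ_k)\exp(\sum y_jY_j)\exp(\sum x_jX_j)$, and let $L$ be its left regular representation on $L^2(N)$. Identify $\lambda\in\mathbb R^p$ with the functional on $\mathfrak n$ given by $\lambda(Z_k)=\lambda_k$, $\lambda(Y_j)=\lambda(X_j)=0$. Let $B(\lambda)=(-\lambda[X_i,Y_j])_{1\le i,j\le d}$, $\Sigma=\{\lambda\in\mathbb R^p:\det B(\lambda)\ne0\}$ and $d\mu(\lambda)=|\det B(\lambda)|\,d\lambda$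 on $\Sigma$. For $\lambda\in\Sigma$ let $\pi_\lambda$ be the irreducible representation of $N$ on $L^2(\mathbb R^d)$ given by $$\pi_\lambda\Big(\exp\big(\textstyle\sum z_kZ_k\big)\exp\big(\sum y_jY_j\big)\exp\big(\sum x_jX_j\big)\Big)F(t)=e^{2\pi i\langle\lambda,z\rangle}e^{2\pi i\langle t,B(\lambda)y\rangle}F(t-x).$$ Let $\mathcal P:L^2(N)\to\int_\Sigma^\oplus L^2(\mathbb R^d)\otimes L^2(\mathbb R^d)\,d\mu(\lambda)$, $\mathcal P\phi=\widehat\phi$, be the Plancherel transform, i.e. the continuous extension of $f\mapsto\big(\int_N f(n)\pi_\lambda(n)\,dn\big)_\lambda$ from $L^1(N)\cap L^2(N)$; here $L^2(\mathbb R^d)\otimes L^2(\mathbb R^d)$ is the space of Hilbert–Schmidt operators on $L^2(\mathbb R^d)$ and $f\otimes u$ is the operator $h\mapsto\langle h,u\rangle f$. For vectors $a\in(0,\infty)^p$ and $q,b\in(0,\infty)^d$ put $$\Gamma_{a,q,b}=\Big\{\prod_{j=1}^{p}\exp\big(\tfrac{m_j}{a_j}Z_j\big)\prod_{j=1}^d\exp\big(\tfrac{k_j}{q_j}Y_j\big)\prod_{j=1}^d\exp\big(\tfrac{n_j}{b_j}X_j\big):m_j,k_j,n_j\in\mathbb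 Z\Big\},$$ $D(q)=\operatorname{diag}(1/q_1,\dots,1/q_d)$ and $A(b)=\operatorname{diag}(1/b_1,\dots,1/b_d)$. Fix $a$ and $q$, let $I\subseteq\{\lambda\in\Sigma:0\le\lambda_k\le a_k\text{ for all }k\}$ be measurable and nonempty, let $s=\sup_{\lambda\in I}|\det B(\lambda)|$ and $b(s)=(s^{1/d},\dots,s^{1/d})$. Let $u\in L^2(\mathbb R^d)$ be a unit vector and let $$\mathcal H=\mathcal P^{-1}\Big(\int_I^\oplus L^2(\mathbb R^d)\otimes u\;d\mu(\lambda)\Big)\subseteq L^2(N).$$ For $\lambda\in I$ let $g(\lambda)\in L^2(\mathbb R^d)$ be such that, for $\mu$-a.e. $\lambda\in I$, the Gabor system $$\big\{t\mapsto e^{2\pi i\langle B(\lambda)D(q)k,\,t\rangle}\,g(\lambda)\big(t-A(b(s))n\big):k,n\in\mathbb Z^d\big\}$$ is a Parseval frame of $L^2(\mathbb R^d)$, and let $\eta\in\mathcal H$ satisfy $$\widehat\eta(\lambda)=\frac{g(\lambda)\otimes u}{\prod_{k=1}^{p}\sqrt{a_k}\;|\det B(\lambda)|^{1/2}}\qquad\text{for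 }\mu\text{-a.e. }\lambda\in I.$$ Then: 1. $\{L(\gamma)\eta:\gamma\in\Gamma_{a,q,b(s)}\}$ is a Parseval frame of $\mathcal H$. 2. If $\mu(I)=\dfrac{\prod_{k=1}^{p}a_k}{|\det D(q)\det A(b(s))|}$, then $\{L(\gamma)\eta:\gamma\in\Gamma_{a,q,b(s)}\}$ is an orthonormal basis of $\mathcal H$. -/

import Mathlib

open MeasureTheory
open scoped ENNReal Matrix

noncomputable section

namespace BandLimited

/-! ### Hilbert space preliminaries -/

/-- `(f i)` is a Parseval frame of the subspace `K`: all members lie in `K`, and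
`∑ |⟨v, f i⟩|² = ‖v‖²` (a convergent sum) for every `v` in `K`. -/
def IsParsevalFrame {ι E : Type*} [NormedAddCommGroup E] [InnerProductSpace ℂ E]
    (f : ι → E) (K : Submodule ℂ E) : Prop :=
  (∀ i, f i ∈ K) ∧ ∀ v ∈ K, HasSum (fun i => ‖inner ℂ v (f i)‖ ^ 2) (‖v‖ ^ 2)

/-- `(f i)` is an orthonormal basis of the subspace `K`: it is orthonormal and its closed
linear span is `K`. -/
def IsONB {ι E : Type*} [NormedAddCommGroup E] [InnerProductSpace ℂ E]
    (f : ι → E) (K : Submodule ℂ E) : Prop :=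
  Orthonormal ℂ f ∧ (Submodule.span ℂ (Set.range f)).topologicalClosure = K

/-- `L²(ℝᵈ)`, for Lebesgue measure. -/
abbrev L2R (d : ℕ) : Type := Lp ℂ 2 (volume : Measure (Fin d → ℝ))

/-- `L²(ℝᵈ) ⊗ L²(ℝᵈ)`, the Hilbert space of Hilbert–Schmidt operators on `L²(ℝᵈ)`, each operator
`T h (t) = ∫ k(t, s) h(s) ds` being given by its kernel `k` in `L²(ℝᵈ × ℝᵈ)`
(so that the Hilbert–Schmidt norm is the `L²` norm of the kernel). -/
abbrev HS (d : ℕ) : Type := Lp ℂ 2 (volume : Measure ((Fin d → ℝ) × (Fin d → ℝ)))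

theorem memLp_tensor {d : ℕ} (f u : L2R d) :
    MemLp (fun p : (Fin d → ℝ) × (Fin d → ℝ) => f p.1 * (starRingEnd ℂ) (u p.2)) 2 volume := by
  have hm : AEStronglyMeasurable
      (fun p : (Fin d → ℝ) × (Fin d → ℝ) => f p.1 * (starRingEnd ℂ) (u p.2)) volume :=
    ((Lp.stronglyMeasurable f).comp_measurable measurable_fst).aestronglyMeasurable.mul
      (Complex.continuous_conj.comp_aestronglyMeasurable
        ((Lp.stronglyMeasurable u).comp_measurable measurable_snd).aestronglyMeasurable)
  rw [memLp_two_iff_integrable_sq_norm hm]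
  have hf := (memLp_two_iff_integrable_sq_norm (Lp.aestronglyMeasurable f)).1 (Lp.memLp f)
  have hu := (memLp_two_iff_integrable_sq_norm (Lp.aestronglyMeasurable u)).1 (Lp.memLp u)
  refine (hf.mul_prod hu).congr (Filter.Eventually.of_forall fun p => ?_)
  simp [mul_pow]

/-- The rank one operator `f ⊗ u : h ↦ ⟨h, u⟩ f`, whose kernel is `f(t) * conj (u(s))`. -/
def tensor {d : ℕ} (f u : L2R d) : HS d := (memLp_tensor f u).toLp _

theorem tensor_add {d : ℕ} (f g u : L2R d) : tensor (f + g) u = tensor f u + tensor g u := by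
  rw [tensor, tensor, tensor, ← MemLp.toLp_add]
  refine MemLp.toLp_congr _ _ ?_
  have h := (Measure.quasiMeasurePreserving_fst
    (μ := (volume : Measure (Fin d → ℝ))) (ν := (volume : Measure (Fin d → ℝ)))).ae
      (Lp.coeFn_add f g)
  filter_upwards [h] with p hp
  rw [hp]
  simp [add_mul]

theorem tensor_smul {d : ℕ} (c : ℂ) (f u : L2R d) : tensor (c • f) u = c • tensor f u := by
  rw [tensor, tensor, ← MemLp.toLp_const_smul]
  refine MemLp.toLp_congr _ _ ?_
  have h := (Measure.quasiMeasurePreserving_fst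
    (μ := (volume : Measure (Fin d → ℝ))) (ν := (volume : Measure (Fin d → ℝ)))).ae
      (Lp.coeFn_smul c f)
  filter_upwards [h] with p hp
  rw [hp]
  simp [mul_assoc]

/-- The subspace `L²(ℝᵈ) ⊗ u` of `L²(ℝᵈ) ⊗ L²(ℝᵈ)`. -/
def tensorRange {d : ℕ} (u : L2R d) : Submodule ℂ (HS d) where
  carrier := Set.range fun f => tensor f u
  zero_mem' := ⟨0, by simpa using tensor_smul (0 : ℂ) (0 : L2R d) u⟩
  add_mem' := by
    rintro _ _ ⟨f, rfl⟩ ⟨g, rfl⟩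
    exact ⟨f + g, tensor_add f g u⟩
  smul_mem' := by
    rintro c _ ⟨f, rfl⟩
    exact ⟨c • f, tensor_smul c f u⟩

/-! ### Time-frequency shifts and Gabor systems -/

theorem memLp_timeFreq {d : ℕ} (ω x : Fin d → ℝ) (F : L2R d) :
    MemLp (fun t : Fin d → ℝ =>
      Complex.exp (((2 * Real.pi * (t ⬝ᵥ ω) : ℝ) : ℂ) * Complex.I) * F (t - x)) 2 volume := by
  have h1 : MemLp (fun t : Fin d → ℝ => F (t - x)) 2 volume :=
    (Lp.memLp F).comp_measurePreserving (measurePreserving_sub_right volume x)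
  have hc : Continuous fun t : Fin d → ℝ =>
      Complex.exp (((2 * Real.pi * (t ⬝ᵥ ω) : ℝ) : ℂ) * Complex.I) := by
    unfold dotProduct
    fun_prop
  refine h1.congr_norm (hc.aestronglyMeasurable.mul h1.1)
    (Filter.Eventually.of_forall fun t => ?_)
  rw [norm_mul, Complex.norm_exp_ofReal_mul_I, one_mul]

/-- The function `t ↦ e^{2πi⟨t, ω⟩} F(t - x)` in `L²(ℝᵈ)`. -/
def timeFreq {d : ℕ} (ω x : Fin d → ℝ) (F : L2R d) : L2R d := (memLp_timeFreq ω x F).toLp _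

/-- The Gabor system `G(g, Aℤᵈ × Bℤᵈ) = {e^{2πi⟨Bk, t⟩} g(t - An) : k, n ∈ ℤᵈ}`. -/
def gaborSystem {d : ℕ} (g : L2R d) (A B : Matrix (Fin d) (Fin d) ℝ) :
    (Fin d → ℤ) × (Fin d → ℤ) → L2R d :=
  fun kn => timeFreq (B *ᵥ fun j => (kn.1 j : ℝ)) (A *ᵥ fun j => (kn.2 j : ℝ)) g

/-! ### The class of two-step nilpotent Lie algebras and their groups -/

/-- A Lie algebra `𝔫` of the class considered, with the fixed basis
`Z₁, …, Z_p, Y₁, …, Y_d, X₁, …, X_d` (so `p = n - 2d`). The last condition is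
square-integrability modulo the center: some (equivalently, the generic) linear functional `ℓ`
on `𝔫` has the center as its stabilizer `{w : ℓ[w, v] = 0 for all v}`. -/
structure NilpotentAlgebra (p d : ℕ) (𝔫 : Type*) [LieRing 𝔫] [LieAlgebra ℝ 𝔫] where
  /-- the fixed basis -/
  basis : Module.Basis (Fin p ⊕ Fin d ⊕ Fin d) ℝ 𝔫
  lie_mem_center : ∀ v w : 𝔫, ⁅v, w⁆ ∈ LieAlgebra.center ℝ 𝔫
  center_eq_span : (LieAlgebra.center ℝ 𝔫).toSubmodule =
    Submodule.span ℝ (Set.range fun k : Fin p => basis (Sum.inl k))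
  lie_Y_Y : ∀ i j : Fin d, ⁅basis (Sum.inr (Sum.inl i)), basis (Sum.inr (Sum.inl j))⁆ = 0
  lie_X_X : ∀ i j : Fin d, ⁅basis (Sum.inr (Sum.inr i)), basis (Sum.inr (Sum.inr j))⁆ = 0
  exists_stabilizer_eq_center : ∃ ℓ : 𝔫 →ₗ[ℝ] ℝ,
    ∀ w : 𝔫, (∀ v : 𝔫, ℓ ⁅w, v⁆ = 0) → w ∈ LieAlgebra.center ℝ 𝔫

variable {p d : ℕ} {𝔫 : Type*} [LieRing 𝔫] [LieAlgebra ℝ 𝔫]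

namespace NilpotentAlgebra

/-- The basis vectors `Z_k` of the center. -/
def Z (D : NilpotentAlgebra p d 𝔫) (k : Fin p) : 𝔫 := D.basis (Sum.inl k)

/-- The basis vectors `Y_j`. -/
def Y (D : NilpotentAlgebra p d 𝔫) (j : Fin d) : 𝔫 := D.basis (Sum.inr (Sum.inl j))

/-- The basis vectors `X_j`. -/
def X (D : NilpotentAlgebra p d 𝔫) (j : Fin d) : 𝔫 := D.basis (Sum.inr (Sum.inr j))

/-- `∑ z_k Z_k`. -/
def sumZ (D : NilpotentAlgebra p d 𝔫) (z : Fin p → ℝ) : 𝔫 := ∑ k, z k • D.Z k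

/-- `∑ y_j Y_j`. -/
def sumY (D : NilpotentAlgebra p d 𝔫) (y : Fin d → ℝ) : 𝔫 := ∑ j, y j • D.Y j

/-- `∑ x_j X_j`. -/
def sumX (D : NilpotentAlgebra p d 𝔫) (x : Fin d → ℝ) : 𝔫 := ∑ j, x j • D.X j

/-- The coordinates of a vector along `Z₁, …, Z_p`. -/
def coordZ (D : NilpotentAlgebra p d 𝔫) : 𝔫 →ₗ[ℝ] (Fin p → ℝ) :=
  LinearMap.pi fun k => D.basis.coord (Sum.inl k)

/-- The coordinates of a vector along `Y₁, …, Y_d`. -/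
def coordY (D : NilpotentAlgebra p d 𝔫) : 𝔫 →ₗ[ℝ] (Fin d → ℝ) :=
  LinearMap.pi fun j => D.basis.coord (Sum.inr (Sum.inl j))

/-- The coordinates of a vector along `X₁, …, X_d`. -/
def coordX (D : NilpotentAlgebra p d 𝔫) : 𝔫 →ₗ[ℝ] (Fin d → ℝ) :=
  LinearMap.pi fun j => D.basis.coord (Sum.inr (Sum.inr j))

/-- A point `λ ∈ ℝᵖ` as the linear functional `(λ₁, …, λ_p, 0, …, 0)` on `𝔫`. -/
def functional (D : NilpotentAlgebra p d 𝔫) (l : Fin p → ℝ) : 𝔫 →ₗ[ℝ] ℝ :=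
  ∑ k, l k • D.basis.coord (Sum.inl k)

/-- The matrix `B(λ)`, with entries `-λ[X_i, Y_j]`. -/
def B (D : NilpotentAlgebra p d 𝔫) (l : Fin p → ℝ) : Matrix (Fin d) (Fin d) ℝ :=
  Matrix.of fun i j => -D.functional l ⁅D.X i, D.Y j⁆

/-- The cross-section `Σ` of the generic coadjoint orbits, inside `𝔷* = ℝᵖ`. -/
def crossSection (D : NilpotentAlgebra p d 𝔫) : Set (Fin p → ℝ) := {l | (D.B l).det ≠ 0}

/-- The Plancherel measure `dμ(λ) = |det B(λ)| dλ` on `Σ`. -/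
def plancherelMeasure (D : NilpotentAlgebra p d 𝔫) : Measure (Fin p → ℝ) :=
  (volume.restrict D.crossSection).withDensity fun l => ENNReal.ofReal |(D.B l).det|

end NilpotentAlgebra

/-- The connected simply connected Lie group `N = exp 𝔫`: its elements are `exp v`, `v ∈ 𝔫`, and
the product is given by the Baker–Campbell–Hausdorff formula, which for a two-step
algebra reads `exp v * exp w = exp (v + w + [v, w] / 2)`. -/
@[ext]
structure ExpGroup (D : NilpotentAlgebra p d 𝔫) where
  /-- the exponential map -/
  exp ::
  /-- the logarithm -/
  log : 𝔫

namespace ExpGroup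

variable (D : NilpotentAlgebra p d 𝔫)

instance : Mul (ExpGroup D) := ⟨fun g h => exp (g.log + h.log + (1 / 2 : ℝ) • ⁅g.log, h.log⁆)⟩
instance : One (ExpGroup D) := ⟨exp 0⟩
instance : Inv (ExpGroup D) := ⟨fun g => exp (-g.log)⟩

variable {D}

theorem log_mul (g h : ExpGroup D) :
    (g * h).log = g.log + h.log + (1 / 2 : ℝ) • ⁅g.log, h.log⁆ := rfl

theorem log_one : (1 : ExpGroup D).log = 0 := rfl

theorem log_inv (g : ExpGroup D) : (g⁻¹).log = -g.log := rfl

theorem lie_lie_left (D : NilpotentAlgebra p d 𝔫) (u v w : 𝔫) : ⁅u, ⁅v, w⁆⁆ = 0 :=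
  (LieModule.mem_maxTrivSubmodule ℝ 𝔫 𝔫 _).1 (D.lie_mem_center v w) u

theorem lie_lie_right (D : NilpotentAlgebra p d 𝔫) (u v w : 𝔫) : ⁅⁅v, w⁆, u⁆ = 0 := by
  rw [← lie_skew, lie_lie_left D, neg_zero]

instance : Group (ExpGroup D) :=
  Group.ofLeftAxioms
    (fun a b c => by
      ext
      simp only [log_mul, add_lie, lie_add, lie_smul, smul_lie, lie_lie_left D,
        lie_lie_right D, smul_zero, add_zero, smul_add]
      abel)
    (fun a => by ext; simp [log_mul, log_one])
    (fun a => by ext; simp [log_mul, log_one, log_inv])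

theorem coordZ_sumZ (z) : D.coordZ (D.sumZ z) = z := by
  ext k
  simp [NilpotentAlgebra.coordZ, NilpotentAlgebra.sumZ, NilpotentAlgebra.Z,
    Finsupp.single_apply]

theorem coordZ_sumY (y) : D.coordZ (D.sumY y) = 0 := by
  ext k
  simp [NilpotentAlgebra.coordZ, NilpotentAlgebra.sumY, NilpotentAlgebra.Y]

theorem coordZ_sumX (x) : D.coordZ (D.sumX x) = 0 := by
  ext k
  simp [NilpotentAlgebra.coordZ, NilpotentAlgebra.sumX, NilpotentAlgebra.X]

theorem coordY_sumZ (z) : D.coordY (D.sumZ z) = 0 := by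
  ext k
  simp [NilpotentAlgebra.coordY, NilpotentAlgebra.sumZ, NilpotentAlgebra.Z]

theorem coordY_sumY (y) : D.coordY (D.sumY y) = y := by
  ext k
  simp [NilpotentAlgebra.coordY, NilpotentAlgebra.sumY, NilpotentAlgebra.Y,
    Finsupp.single_apply]

theorem coordY_sumX (x) : D.coordY (D.sumX x) = 0 := by
  ext k
  simp [NilpotentAlgebra.coordY, NilpotentAlgebra.sumX, NilpotentAlgebra.X]

theorem coordX_sumZ (z) : D.coordX (D.sumZ z) = 0 := by
  ext k
  simp [NilpotentAlgebra.coordX, NilpotentAlgebra.sumZ, NilpotentAlgebra.Z]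

theorem coordX_sumY (y) : D.coordX (D.sumY y) = 0 := by
  ext k
  simp [NilpotentAlgebra.coordX, NilpotentAlgebra.sumY, NilpotentAlgebra.Y]

theorem coordX_sumX (x) : D.coordX (D.sumX x) = x := by
  ext k
  simp [NilpotentAlgebra.coordX, NilpotentAlgebra.sumX, NilpotentAlgebra.X,
    Finsupp.single_apply]

theorem sum_coord (v : 𝔫) :
    D.sumZ (D.coordZ v) + D.sumY (D.coordY v) + D.sumX (D.coordX v) = v := by
  conv_rhs => rw [← D.basis.sum_repr v, Fintype.sum_sum_type, Fintype.sum_sum_type]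
  simp [NilpotentAlgebra.sumZ, NilpotentAlgebra.sumY,
    NilpotentAlgebra.sumX, NilpotentAlgebra.Z, NilpotentAlgebra.Y, NilpotentAlgebra.X,
    NilpotentAlgebra.coordZ, NilpotentAlgebra.coordY, NilpotentAlgebra.coordX, add_assoc]

theorem sumZ_mem_center (z) : D.sumZ z ∈ LieAlgebra.center ℝ 𝔫 := by
  rw [← LieSubmodule.mem_toSubmodule, D.center_eq_span]
  exact Submodule.sum_mem _ fun k _ =>
    Submodule.smul_mem _ _ (Submodule.subset_span ⟨k, rfl⟩)

theorem lie_sumZ (v : 𝔫) (z) : ⁅v, D.sumZ z⁆ = 0 :=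
  (LieModule.mem_maxTrivSubmodule ℝ 𝔫 𝔫 _).1 (sumZ_mem_center z) v

theorem sumZ_lie (v : 𝔫) (z) : ⁅D.sumZ z, v⁆ = 0 := by
  rw [← lie_skew, lie_sumZ, neg_zero]

theorem lie_sumY_sumY (y y') : ⁅D.sumY y, D.sumY y'⁆ = 0 := by
  simp [NilpotentAlgebra.sumY, NilpotentAlgebra.Y, sum_lie, lie_sum,
    D.lie_Y_Y]

theorem lie_sumX_sumX (x x') : ⁅D.sumX x, D.sumX x'⁆ = 0 := by
  simp [NilpotentAlgebra.sumX, NilpotentAlgebra.X, sum_lie, lie_sum,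
    D.lie_X_X]

theorem sumZ_coordZ_lie (v w : 𝔫) : D.sumZ (D.coordZ ⁅v, w⁆) = ⁅v, w⁆ := by
  have h := D.lie_mem_center v w
  generalize ⁅v, w⁆ = x at h ⊢
  rw [← LieSubmodule.mem_toSubmodule, D.center_eq_span] at h
  induction h using Submodule.span_induction with
  | mem x hx =>
    obtain ⟨k, rfl⟩ := hx
    have : D.basis (Sum.inl k) = D.sumZ (Pi.single k 1) := by
      simp [NilpotentAlgebra.sumZ, NilpotentAlgebra.Z, Pi.single_apply, ite_smul]
    simp only [this, coordZ_sumZ]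
  | zero => simp [NilpotentAlgebra.sumZ]
  | add x y _ _ hx hy =>
    rw [map_add]
    conv_rhs => rw [← hx, ← hy]
    simp [NilpotentAlgebra.sumZ, add_smul, Finset.sum_add_distrib]
  | smul c x _ hx =>
    rw [map_smul]
    conv_rhs => rw [← hx]
    simp [NilpotentAlgebra.sumZ, mul_smul, Finset.smul_sum]

variable (D)

/-- The point `exp(∑ z_k Z_k) exp(∑ y_j Y_j) exp(∑ x_j X_j)` of `N`. -/
def mk3 (c : (Fin p → ℝ) × (Fin d → ℝ) × (Fin d → ℝ)) : ExpGroup D :=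
  exp (D.sumZ c.1) * exp (D.sumY c.2.1) * exp (D.sumX c.2.2)

variable {D}

theorem log_mk3 (c) : (mk3 D c).log = D.sumZ c.1 + D.sumY c.2.1 + D.sumX c.2.2 +
    (1 / 2 : ℝ) • ⁅D.sumY c.2.1, D.sumX c.2.2⁆ := by
  simp [mk3, log_mul, sumZ_lie]

variable (D)

/-- The coordinates `(z, y, x)` of a point
`exp(∑ z_k Z_k) exp(∑ y_j Y_j) exp(∑ x_j X_j)` of `N`. -/
def coords : ExpGroup D ≃ (Fin p → ℝ) × (Fin d → ℝ) × (Fin d → ℝ) where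
  toFun g := (D.coordZ g.log -
      (1 / 2 : ℝ) • D.coordZ ⁅D.sumY (D.coordY g.log), D.sumX (D.coordX g.log)⁆,
    D.coordY g.log, D.coordX g.log)
  invFun := mk3 D
  left_inv g := by
    ext
    have h := sum_coord (D := D) g.log
    set w := ⁅D.sumY (D.coordY g.log), D.sumX (D.coordX g.log)⁆ with hw
    have e : D.sumZ (D.coordZ g.log - (1 / 2 : ℝ) • D.coordZ w) =
        D.sumZ (D.coordZ g.log) - (1 / 2 : ℝ) • w := by
      conv_rhs => rw [hw, ← sumZ_coordZ_lie (D := D), ← hw]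
      simp only [NilpotentAlgebra.sumZ, Pi.sub_apply, Pi.smul_apply, sub_smul,
        Finset.sum_sub_distrib, Finset.smul_sum, smul_assoc]
    rw [log_mk3]
    simp only
    rw [e, ← hw]
    conv_rhs => rw [← h]
    abel
  right_inv c := by
    have e1 : D.coordY (mk3 D c).log = c.2.1 := by
      rw [log_mk3, ← sumZ_coordZ_lie (D := D)]
      simp [coordY_sumZ, coordY_sumY, coordY_sumX]
    have e2 : D.coordX (mk3 D c).log = c.2.2 := by
      rw [log_mk3, ← sumZ_coordZ_lie (D := D)]
      simp [coordX_sumZ, coordX_sumY, coordX_sumX]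
    have e3 : D.coordZ (mk3 D c).log = c.1 +
        (1 / 2 : ℝ) • D.coordZ ⁅D.sumY c.2.1, D.sumX c.2.2⁆ := by
      rw [log_mk3]
      simp [coordZ_sumZ, coordZ_sumY, coordZ_sumX]
    simp only [e1, e2, e3, add_sub_cancel_right]

theorem coords_mul (g h : ExpGroup D) : coords D (g * h) =
    ((coords D g).1 + (coords D h).1 +
        D.coordZ ⁅D.sumX (coords D g).2.2, D.sumY (coords D h).2.1⁆,
      (coords D g).2.1 + (coords D h).2.1, (coords D g).2.2 + (coords D h).2.2) := by
  obtain ⟨c, rfl⟩ := (coords D).symm.surjective g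
  obtain ⟨c', rfl⟩ := (coords D).symm.surjective h
  simp only [Equiv.apply_symm_apply]
  rw [← Equiv.eq_symm_apply]
  change mk3 D c * mk3 D c' = mk3 D _
  ext
  have eZ : D.sumZ (c.1 + c'.1 + D.coordZ ⁅D.sumX c.2.2, D.sumY c'.2.1⁆) =
      D.sumZ c.1 + D.sumZ c'.1 + ⁅D.sumX c.2.2, D.sumY c'.2.1⁆ := by
    conv_rhs => rw [← sumZ_coordZ_lie (D := D)]
    simp [NilpotentAlgebra.sumZ, add_smul, Finset.sum_add_distrib]
  have eY : D.sumY (c.2.1 + c'.2.1) = D.sumY c.2.1 + D.sumY c'.2.1 := by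
    simp [NilpotentAlgebra.sumY, add_smul, Finset.sum_add_distrib]
  have eX : D.sumX (c.2.2 + c'.2.2) = D.sumX c.2.2 + D.sumX c'.2.2 := by
    simp [NilpotentAlgebra.sumX, add_smul, Finset.sum_add_distrib]
  rw [log_mul, log_mk3, log_mk3, log_mk3]
  simp only
  rw [eZ, eY, eX]
  simp only [add_lie, lie_add, lie_smul, smul_lie, lie_lie_left D, lie_lie_right D,
    sumZ_lie, lie_sumZ, lie_sumY_sumY, lie_sumX_sumX, smul_zero, add_zero, zero_add, smul_add]
  rw [← lie_skew (D.sumY c'.2.1) (D.sumX c.2.2)]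
  module

instance : TopologicalSpace (ExpGroup D) := TopologicalSpace.induced (coords D) inferInstance
instance : MeasurableSpace (ExpGroup D) := borel _
instance : BorelSpace (ExpGroup D) := ⟨rfl⟩

/-- The coordinates as a homeomorphism. -/
def coordsHomeo : ExpGroup D ≃ₜ (Fin p → ℝ) × (Fin d → ℝ) × (Fin d → ℝ) :=
  (coords D).toHomeomorphOfIsInducing ⟨rfl⟩

/-- The coordinates as a measurable equivalence. -/
def coordsMeas : ExpGroup D ≃ᵐ (Fin p → ℝ) × (Fin d → ℝ) × (Fin d → ℝ) :=
  (coordsHomeo D).toMeasurableEquiv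

/-- The canonical Haar measure of `N`: Lebesgue measure in the coordinates `(z, y, x)`. -/
def haar : Measure (ExpGroup D) := Measure.map (coordsMeas D).symm volume

theorem measurePreserving_coords : MeasurePreserving (coordsMeas D) (haar D) volume :=
  ((coordsMeas D).symm.measurable.measurePreserving volume).symm (coordsMeas D).symm

theorem measurePreserving_mul_left (g : ExpGroup D) :
    MeasurePreserving (fun h => g * h) (haar D) (haar D) := by
  set c := coords D g with hc
  have hβ : Continuous fun y : (Fin d → ℝ) => D.coordZ ⁅D.sumX c.2.2, D.sumY y⁆ := by
    simp only [NilpotentAlgebra.sumY, lie_sum, map_sum, lie_smul, map_smul]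
    fun_prop
  have key : MeasurePreserving
      (fun v : ((Fin d → ℝ) × (Fin d → ℝ)) × (Fin p → ℝ) =>
        ((c.2.1 + v.1.1, c.2.2 + v.1.2),
          c.1 + D.coordZ ⁅D.sumX c.2.2, D.sumY v.1.1⁆ + v.2)) volume volume := by
    have h1 : MeasurePreserving
        (fun v : (Fin d → ℝ) × (Fin d → ℝ) => (c.2.1 + v.1, c.2.2 + v.2)) volume volume :=
      (measurePreserving_add_left volume c.2.1).prod (measurePreserving_add_left volume c.2.2)
    refine h1.skew_product
      (g := fun v z => c.1 + D.coordZ ⁅D.sumX c.2.2, D.sumY v.1⁆ + z) ?_ ?_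
    · refine Continuous.measurable ?_
      exact (continuous_const.add (hβ.comp (continuous_fst.comp continuous_fst))).add
        continuous_snd
    · exact Filter.Eventually.of_forall fun v => (measurePreserving_add_left volume _).map_eq
  have hs1 : MeasurePreserving
      (Prod.swap : (Fin p → ℝ) × ((Fin d → ℝ) × (Fin d → ℝ)) → _) volume volume :=
    Measure.measurePreserving_swap
  have hs2 : MeasurePreserving
      (Prod.swap : ((Fin d → ℝ) × (Fin d → ℝ)) × (Fin p → ℝ) → _) volume volume :=
    Measure.measurePreserving_swap
  have hsymm : MeasurePreserving (coordsMeas D).symm volume (haar D) :=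
    (coordsMeas D).symm.measurable.measurePreserving volume
  convert hsymm.comp (hs2.comp (key.comp (hs1.comp (measurePreserving_coords D)))) using 1
  funext h
  change g * h = (coords D).symm _
  rw [Equiv.eq_symm_apply, coords_mul]
  change _ = (c.1 + D.coordZ ⁅D.sumX c.2.2, D.sumY (coords D h).2.1⁆ + (coords D h).1,
    c.2.1 + (coords D h).2.1, c.2.2 + (coords D h).2.2)
  rw [add_right_comm]

/-- `L²(N)`. -/
abbrev L2N : Type _ := Lp ℂ 2 (haar D)

/-- The left regular representation, `(L(g) φ)(x) = φ(g⁻¹ x)`. -/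
def leftRegular (g : ExpGroup D) : L2N D →ₗᵢ[ℂ] L2N D :=
  Lp.compMeasurePreservingₗᵢ ℂ (fun h => g⁻¹ * h) (measurePreserving_mul_left D g⁻¹)

/-- The irreducible representation `π_λ` in its realization on `L²(ℝᵈ)`: for
`n = exp(∑ z_k Z_k) exp(∑ y_j Y_j) exp(∑ x_j X_j)`,
`(π_λ(n) F)(t) = e^{2πi⟨λ, z⟩} e^{2πi⟨t, B(λ) y⟩} F(t - x)`. -/
def rep (l : Fin p → ℝ) (n : ExpGroup D) (F : L2R d) : L2R d :=
  Complex.exp (((2 * Real.pi * (l ⬝ᵥ (coords D n).1) : ℝ) : ℂ) * Complex.I) •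
    timeFreq (D.B l *ᵥ (coords D n).2.1) (coords D n).2.2 F

/-- The Hilbert–Schmidt operator `T` with kernel `k` is the operator-valued Fourier transform
`∫_N f(n) π_λ(n) dn` of `f` at `λ`, the integral being taken in the weak sense:
`⟨T h, h'⟩ = ∫_N f(n) ⟨π_λ(n) h, h'⟩ dn` for all `h, h'`. The left-hand side is written as the
Hilbert–Schmidt inner product of `T` with the rank one operator `h' ⊗ h`. (Mathlib's inner
products are conjugate linear in the first variable.) -/
def IsFourierAt (f : ExpGroup D → ℂ) (l : Fin p → ℝ) (k : HS d) : Prop :=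
  ∀ h h' : L2R d, inner ℂ (tensor h' h) k = ∫ n, f n * inner ℂ h' (rep D l n h) ∂haar D

/-- The direct integral `∫^⊕_Σ L²(ℝᵈ) ⊗ L²(ℝᵈ) dμ(λ)` (of a constant field of Hilbert spaces). -/
abbrev DirectIntegral : Type _ := Lp (HS d) 2 D.plancherelMeasure

/-- The graph of the Fourier transform on `L¹(N) ∩ L²(N)`. -/
def fourierGraph : Set (L2N D × DirectIntegral D) :=
  {x | Integrable x.1 (haar D) ∧ ∀ᵐ l ∂D.plancherelMeasure, IsFourierAt D x.1 l (x.2 l)}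

/-- The graph of the Plancherel transform: the closed subspace generated by the graph of the
Fourier transform on `L¹(N) ∩ L²(N)`. -/
def plancherelGraph : Submodule ℂ (L2N D × DirectIntegral D) :=
  (Submodule.span ℂ (fourierGraph D)).topologicalClosure

/-- `φ̂ = Φ`: the field `Φ` is the Plancherel transform of `φ`. -/
def IsPlancherelTransform (φ : L2N D) (Φ : DirectIntegral D) : Prop :=
  (φ, Φ) ∈ plancherelGraph D

/-- The subspace `F = ∫^⊕_I L²(ℝᵈ) ⊗ u dμ(λ)` of the direct integral over `Σ`. -/
def fieldSpace (I : Set (Fin p → ℝ)) (u : L2R d) : Submodule ℂ (DirectIntegral D) where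
  carrier := {Φ | ∀ᵐ l ∂D.plancherelMeasure,
    (l ∈ I → Φ l ∈ tensorRange u) ∧ (l ∉ I → Φ l = 0)}
  zero_mem' := by
    filter_upwards [Lp.coeFn_zero (HS d) 2 D.plancherelMeasure] with l hl
    rw [hl]
    exact ⟨fun _ => Submodule.zero_mem _, fun _ => rfl⟩
  add_mem' := by
    intro Φ Ψ hΦ hΨ
    filter_upwards [hΦ, hΨ, Lp.coeFn_add Φ Ψ] with l h1 h2 hl
    rw [hl]
    exact ⟨fun h => Submodule.add_mem _ (h1.1 h) (h2.1 h), fun h => by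
      simp [h1.2 h, h2.2 h]⟩
  smul_mem' := by
    intro c Φ hΦ
    filter_upwards [hΦ, Lp.coeFn_smul c Φ] with l h1 hl
    rw [hl]
    exact ⟨fun h => Submodule.smul_mem _ _ (h1.1 h), fun h => by simp [h1.2 h]⟩

/-- The multiplicity-free band-limited space `H = P⁻¹(F)`, that is, the space of all `φ ∈ L²(N)`
whose Plancherel transform lies in `F = ∫^⊕_I L²(ℝᵈ) ⊗ u dμ(λ)`. -/
def bandSpace (I : Set (Fin p → ℝ)) (u : L2R d) : Submodule ℂ (L2N D) :=
  (plancherelGraph D ⊓ (fieldSpace D I u).comap (LinearMap.snd ℂ _ _)).map (LinearMap.fst ℂ _ _)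

/-- The quasi-lattice `Γ_{a,q,b}` of all products
`∏ exp((m_j/a_j) Z_j) ∏ exp((k_j/q_j) Y_j) ∏ exp((n_j/b_j) X_j)` with integers `m_j, k_j, n_j`. -/
def quasiLattice (a : Fin p → ℝ) (q b : Fin d → ℝ) : Set (ExpGroup D) :=
  {γ | ∃ (m : Fin p → ℤ) (k n : Fin d → ℤ),
    γ = (List.ofFn fun j => (exp ((m j / a j : ℝ) • D.Z j) : ExpGroup D)).prod *
      (List.ofFn fun j => (exp ((k j / q j : ℝ) • D.Y j) : ExpGroup D)).prod *
      (List.ofFn fun j => (exp ((n j / b j : ℝ) • D.X j) : ExpGroup D)).prod}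

/-- `s = sup_{λ ∈ I} |det B(λ)|` (used for nonempty bounded `I`, where the set is bounded). -/
def sSupDet (I : Set (Fin p → ℝ)) : ℝ := sSup ((fun l => |(D.B l).det|) '' I)

/-- The vector `b(s) = (s^{1/d}, …, s^{1/d})`. -/
def bVec (I : Set (Fin p → ℝ)) : Fin d → ℝ := fun _ => sSupDet D I ^ (1 / d : ℝ)

end ExpGroup

/-- The diagonal matrix with entries `1 / v_i`, denoted `D(q)` for `v = q` and `A(b)` for
`v = b`. -/
def invDiag {d : ℕ} (v : Fin d → ℝ) : Matrix (Fin d) (Fin d) ℝ :=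
  Matrix.diagonal fun i => 1 / v i

end BandLimited

end

/-!
The Plancherel transform turns `L(γ)` into the field of operators `T ↦ π_λ(γ) ∘ T`, so for
`v ∈ H` with Plancherel transform `V` the coefficients `⟨v, L(γ)η⟩` are integrals over `I`. For
`γ` with integer coordinates `(m, k, n)`, the central coordinate `m` enters only through the
character `λ ↦ exp(2πi ∑ m_j λ_j / a_j)`. Since `I` lies in a translate of the box `∏ [0, a_j]`,
Parseval's identity for Fourier series carries out the sum over `m`; the remaining sum over `(k, n)`
under the integral is, fibre by fibre, the Parseval identity of the Gabor frame of `g(λ)`.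

The window of a Gabor Parseval frame over the lattice `A ℤᵈ × B ℤᵈ` satisfies
`‖g‖² = |det A det B|`. Hence `‖η‖² = |det D(q) det A(b)| μ(I) / ∏ a_k`, and when this equals `1`
the orbit is a Parseval frame of unit vectors, which is an orthonormal basis.
-/

noncomputable section

open scoped FourierTransform

namespace BandLimited

/-! ### Sums and integrals of squared norms -/

section EnormSq

variable {ι α E : Type*} [MeasurableSpace α] {μ : Measure α}

theorem hasSum_norm_sq_iff [SeminormedAddCommGroup E] {f : ι → E} {s : ℝ} (hs : 0 ≤ s) :
    HasSum (fun i => ‖f i‖ ^ 2) s ↔ ∑' i, ‖f i‖ₑ ^ 2 = ENNReal.ofReal s := by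
  lift s to NNReal using hs
  rw [ENNReal.ofReal_coe_nnreal, ← ENNReal.summable.hasSum_iff]
  simp only [enorm_eq_nnnorm, ← ENNReal.coe_pow, ENNReal.hasSum_coe, ← coe_nnnorm,
    ← NNReal.coe_pow, NNReal.hasSum_coe]

theorem lintegral_enorm_sq_eq_eLpNorm_sq [SeminormedAddCommGroup E] (f : α → E) :
    ∫⁻ x, ‖f x‖ₑ ^ 2 ∂μ = eLpNorm f 2 μ ^ 2 := by
  simpa using (eLpNorm_nnreal_pow_eq_lintegral (f := f) (μ := μ) (p := 2) two_ne_zero).symm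

variable [NormedAddCommGroup E]

theorem lintegral_enorm_sq_coeFn (f : Lp E 2 μ) : ∫⁻ x, ‖f x‖ₑ ^ 2 ∂μ = ‖f‖ₑ ^ 2 := by
  rw [lintegral_enorm_sq_eq_eLpNorm_sq, Lp.enorm_def]

theorem memLp_two_iff_lintegral_enorm_sq_ne_top {f : α → E} (hf : AEStronglyMeasurable f μ) :
    MemLp f 2 μ ↔ ∫⁻ x, ‖f x‖ₑ ^ 2 ∂μ ≠ ∞ := by
  rw [lintegral_enorm_sq_eq_eLpNorm_sq, Ne, ENNReal.pow_eq_top_iff]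
  simp [MemLp, hf, lt_top_iff_ne_top]

end EnormSq

/-! ### Parseval frames of unit vectors -/

namespace IsParsevalFrame

variable {ι E : Type*} [NormedAddCommGroup E] [InnerProductSpace ℂ E] {f : ι → E}
  {K : Submodule ℂ E}

theorem orthonormal (h : IsParsevalFrame f K) (h1 : ∀ i, ‖f i‖ = 1) : Orthonormal ℂ f := by
  classical
  refine ⟨h1, fun i j hij => ?_⟩
  have hsum : ∑ k ∈ ({i, j} : Finset ι), ‖inner ℂ (f i) (f k)‖ ^ 2 ≤ ‖f i‖ ^ 2 :=
    sum_le_hasSum _ (fun k _ => by positivity) (h.2 (f i) (h.1 i))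
  rw [Finset.sum_pair hij, inner_self_eq_norm_sq_to_K, h1] at hsum
  norm_num at hsum
  exact hsum

theorem eq_zero_of_inner_eq_zero (h : IsParsevalFrame f K) {v : E} (hv : v ∈ K)
    (hz : ∀ i, inner ℂ v (f i) = 0) : v = 0 := by
  have hsum := h.2 v hv
  simp only [hz, norm_zero, ne_eq, OfNat.ofNat_ne_zero, not_false_eq_true, zero_pow] at hsum
  simpa using hsum.unique hasSum_zero

theorem topologicalClosure_span [CompleteSpace E] (h : IsParsevalFrame f K)
    (hK : IsClosed (K : Set E)) : (Submodule.span ℂ (Set.range f)).topologicalClosure = K := by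
  set W := (Submodule.span ℂ (Set.range f)).topologicalClosure
  have hWK : W ≤ K := Submodule.topologicalClosure_minimal _
    (Submodule.span_le.2 (Set.range_subset_iff.2 h.1)) hK
  have : CompleteSpace W := (Submodule.isClosed_topologicalClosure _).completeSpace_coe
  have hbot : Wᗮ ⊓ K = ⊥ := (Submodule.eq_bot_iff _).2 fun v hv =>
    h.eq_zero_of_inner_eq_zero hv.2 fun i => (Submodule.mem_orthogonal' _ _).1 hv.1 _
      (Submodule.le_topologicalClosure _ (Submodule.subset_span ⟨i, rfl⟩))
  simpa [hbot] using Submodule.sup_orthogonal_inf_of_hasOrthogonalProjection hWK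

theorem isONB [CompleteSpace E] (h : IsParsevalFrame f K) (h1 : ∀ i, ‖f i‖ = 1)
    (hK : IsClosed (K : Set E)) : IsONB f K :=
  ⟨h.orthonormal h1, h.topologicalClosure_span hK⟩

end IsParsevalFrame

/-! ### Linear changes of variables -/

section MulVec

variable {ι E : Type*} [Fintype ι] [DecidableEq ι] {M : Matrix ι ι ℝ}

theorem measurableEmbedding_mulVec (hM : M.det ≠ 0) :
    MeasurableEmbedding fun t : ι → ℝ => M *ᵥ t :=
  (Matrix.toLin' M).continuous_of_finiteDimensional.measurableEmbedding
    (Matrix.mulVec_injective_of_isUnit ((Matrix.isUnit_iff_isUnit_det M).2 hM.isUnit))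

theorem map_mulVec_volume (hM : M.det ≠ 0) :
    Measure.map (fun t : ι → ℝ => M *ᵥ t) volume = ENNReal.ofReal |M.det|⁻¹ • volume := by
  rw [← abs_inv]
  exact Real.map_matrix_volume_pi_eq_smul_volume_pi hM

theorem quasiMeasurePreserving_mulVec (hM : M.det ≠ 0) :
    Measure.QuasiMeasurePreserving fun t : ι → ℝ => M *ᵥ t :=
  ⟨(measurableEmbedding_mulVec hM).measurable,
    map_mulVec_volume hM ▸ Measure.smul_absolutelyContinuous⟩

theorem lintegral_comp_mulVec (hM : M.det ≠ 0) (f : (ι → ℝ) → ℝ≥0∞) :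
    ∫⁻ t, f (M *ᵥ t) = ENNReal.ofReal |M.det|⁻¹ * ∫⁻ t, f t := by
  rw [← (measurableEmbedding_mulVec hM).lintegral_map f, map_mulVec_volume hM,
    lintegral_smul_measure, smul_eq_mul]

theorem integral_comp_mulVec [NormedAddCommGroup E] [NormedSpace ℝ E] (hM : M.det ≠ 0)
    (f : (ι → ℝ) → E) : ∫ t, f (M *ᵥ t) = |M.det|⁻¹ • ∫ t, f t := by
  rw [← (measurableEmbedding_mulVec hM).integral_map f, map_mulVec_volume hM,
    integral_smul_measure, ENNReal.toReal_ofReal (by positivity)]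

theorem memLp_comp_mulVec [NormedAddCommGroup E] (hM : M.det ≠ 0) {f : (ι → ℝ) → E} {r : ℝ≥0∞}
    (hf : MemLp f r) : MemLp (fun t => f (M *ᵥ t)) r := by
  refine MemLp.comp_of_map ?_ (measurableEmbedding_mulVec hM).measurable.aemeasurable
  rw [map_mulVec_volume hM]
  exact hf.smul_measure ENNReal.ofReal_ne_top

theorem inv_mulVec_mulVec (hM : M.det ≠ 0) (t : ι → ℝ) : M⁻¹ *ᵥ (M *ᵥ t) = t := by
  rw [Matrix.mulVec_mulVec, Matrix.nonsing_inv_mul _ hM.isUnit, Matrix.one_mulVec]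

theorem mulVec_inv_mulVec (hM : M.det ≠ 0) (t : ι → ℝ) : M *ᵥ (M⁻¹ *ᵥ t) = t := by
  rw [Matrix.mulVec_mulVec, Matrix.mul_nonsing_inv _ hM.isUnit, Matrix.one_mulVec]

theorem det_inv_ne_zero (hM : M.det ≠ 0) : M⁻¹.det ≠ 0 := by
  simpa [Matrix.det_nonsing_inv] using hM

end MulVec

/-! ### Fourier series on parallelepipeds -/

section FourierSeries

variable {ι : Type*}

/-- The half-open unit cube `∏ (cᵢ, cᵢ + 1]`, a fundamental domain of the integer lattice. It is
written in the form in which Mathlib's Fourier coefficients on the torus are integrals over it. -/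
def unitCube (c : ι → ℝ) : Set (ι → ℝ) := {x | ∀ i, x i ∈ Set.Ioc (c i) (c i + 1)}

theorem mem_unitCube_intCast_iff (x : ι → ℝ) (c : ι → ℤ) :
    x ∈ unitCube (fun i => (c i : ℝ)) ↔ c = fun i => ⌈x i⌉ - 1 := by
  simp only [unitCube, Set.mem_ofPred_eq, Set.mem_Ioc, funext_iff]
  refine forall_congr' fun i => ?_
  have hceil := Int.ceil_eq_iff (z := c i + 1) (a := x i)
  push_cast at hceil
  rw [add_sub_cancel_right] at hceil
  rw [← hceil, eq_sub_iff_add_eq, eq_comm]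

theorem measurableSet_unitCube [Countable ι] (c : ι → ℝ) : MeasurableSet (unitCube c) :=
  MeasurableSet.univ_pi' fun _ => measurableSet_Ioc

variable [Fintype ι]

theorem volume_unitCube (c : ι → ℝ) : volume (unitCube c) = 1 := by
  have hpi : unitCube c = Set.univ.pi fun i => Set.Ioc (c i) (c i + 1) := by
    ext x; simp [unitCube]
  rw [hpi, Real.volume_pi_Ioc]
  simp

theorem mFourier_coe (n : ι → ℤ) (x : ι → ℝ) :
    UnitAddTorus.mFourier n (fun i => (x i : UnitAddCircle)) =
      𝐞 ((fun i => (n i : ℝ)) ⬝ᵥ x) := by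
  simp only [UnitAddTorus.mFourier, ContinuousMap.coe_mk, fourier_coe_apply,
    Real.fourierChar_apply, dotProduct]
  rw [← Complex.exp_sum]
  push_cast
  simp only [Finset.mul_sum, Finset.sum_mul]
  congr! 2
  ring

theorem hasSum_norm_sq_setIntegral_unitCube (c : ι → ℝ) {h : (ι → ℝ) → ℂ}
    (hh : MemLp h 2 (volume.restrict (unitCube c))) :
    HasSum (fun k : ι → ℤ =>
        ‖∫ t in unitCube c, (𝐞 ((fun i => ((-k) i : ℝ)) ⬝ᵥ t) : ℂ) * h t‖ ^ 2)
      (∫ t in unitCube c, ‖h t‖ ^ 2) := by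
  let _ : MeasureSpace UnitAddCircle := ⟨AddCircle.haarAddCircle⟩
  let S : UnitAddTorus ι → (ι → ℝ) := fun x => (UnitAddTorus.measurableEquivPiIoc c x : ι → ℝ)
  have hS : MeasurePreserving S volume (volume.restrict (unitCube c)) :=
    (measurePreserving_subtype_coe (measurableSet_unitCube c)).comp
      (UnitAddTorus.measurePreserving_equivPiIoc c)
  have hSemb : MeasurableEmbedding S :=
    (MeasurableEmbedding.subtype_coe (measurableSet_unitCube c)).comp
      (UnitAddTorus.measurableEquivPiIoc c).measurableEmbedding
  have hS_coe : ∀ x ∈ unitCube c, S (fun i => (x i : UnitAddCircle)) = x := fun x hx =>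
    congrArg Subtype.val ((UnitAddTorus.measurableEquivPiIoc c).apply_symm_apply ⟨x, hx⟩)
  have hf : MemLp (fun x => h (S x)) 2 volume := hh.comp_measurePreserving hS
  have hcoeff : ∀ n, UnitAddTorus.mFourierCoeff hf.toLp n =
      ∫ t in unitCube c, (𝐞 ((fun i => ((-n) i : ℝ)) ⬝ᵥ t) : ℂ) * h t := fun n => by
    have htoLp : UnitAddTorus.mFourierCoeff hf.toLp n =
        UnitAddTorus.mFourierCoeff (fun x => h (S x)) n := by
      refine integral_congr_ae ?_
      filter_upwards [hf.coeFn_toLp] with x hx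
      rw [hx]
    rw [htoLp, UnitAddTorus.mFourierCoeff_eq_integral _ _ c]
    refine setIntegral_congr_fun (measurableSet_unitCube c) fun x hx => ?_
    simp only [hS_coe x hx, mFourier_coe, smul_eq_mul]
  have hnorm : ∫ x, ‖hf.toLp _ x‖ ^ 2 = ∫ t in unitCube c, ‖h t‖ ^ 2 := by
    rw [← hS.integral_comp hSemb]
    refine integral_congr_ae ?_
    filter_upwards [hf.coeFn_toLp] with x hx
    rw [hx]
  simpa only [hcoeff, hnorm] using UnitAddTorus.hasSum_sq_mFourierCoeff hf.toLp

theorem tsum_enorm_sq_setIntegral_unitCube (c : ι → ℝ) {h : (ι → ℝ) → ℂ}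
    (hh : MemLp h 2 (volume.restrict (unitCube c))) :
    ∑' k : ι → ℤ, ‖∫ t in unitCube c, (𝐞 ((fun i => (k i : ℝ)) ⬝ᵥ t) : ℂ) * h t‖ₑ ^ 2 =
      ∫⁻ t in unitCube c, ‖h t‖ₑ ^ 2 := by
  have hsum := (hasSum_norm_sq_iff (integral_nonneg fun _ => by positivity)).1
    (hasSum_norm_sq_setIntegral_unitCube c hh)
  rw [ofReal_integral_eq_lintegral_ofReal ((memLp_two_iff_integrable_sq_norm hh.1).1 hh)
    (Filter.Eventually.of_forall fun _ => by positivity)] at hsum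
  simp only [ENNReal.ofReal_pow (norm_nonneg _), ofReal_norm] at hsum
  rw [← hsum, ← (Equiv.neg (ι → ℤ)).tsum_eq]
  rfl

theorem tsum_enorm_sq_integral_of_unitCube (c : ι → ℝ) {h : (ι → ℝ) → ℂ} (hh : MemLp h 2)
    (hc : ∀ᵐ t, t ∉ unitCube c → h t = 0) :
    ∑' k : ι → ℤ, ‖∫ t, (𝐞 ((fun i => (k i : ℝ)) ⬝ᵥ t) : ℂ) * h t‖ₑ ^ 2 =
      ∫⁻ t, ‖h t‖ₑ ^ 2 := by
  have hint : ∀ k : ι → ℤ, ∫ t, (𝐞 ((fun i => (k i : ℝ)) ⬝ᵥ t) : ℂ) * h t =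
      ∫ t in unitCube c, (𝐞 ((fun i => (k i : ℝ)) ⬝ᵥ t) : ℂ) * h t := fun k => by
    refine (setIntegral_eq_integral_of_ae_compl_eq_zero ?_).symm
    filter_upwards [hc] with t ht htc
    rw [ht htc, mul_zero]
  have hlint : ∫⁻ t in unitCube c, ‖h t‖ₑ ^ 2 = ∫⁻ t, ‖h t‖ₑ ^ 2 := by
    rw [← lintegral_indicator (measurableSet_unitCube c)]
    refine lintegral_congr_ae ?_
    filter_upwards [hc] with t ht
    by_cases htc : t ∈ unitCube c <;> simp [htc, ht]
  simp only [hint, tsum_enorm_sq_setIntegral_unitCube c (hh.restrict _), hlint]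

/-- The parallelepiped `M⁻¹(c + (0, 1]ᵈ)`. It is a preimage under `M`, so that no
invertibility is needed to define it. -/
def latticeCell (M : Matrix ι ι ℝ) (c : ι → ℝ) : Set (ι → ℝ) := {t | M *ᵥ t ∈ unitCube c}

theorem tsum_enorm_sq_integral_of_latticeCell [DecidableEq ι] {M : Matrix ι ι ℝ}
    (hM : M.det ≠ 0) (c : ι → ℝ) {h : (ι → ℝ) → ℂ} (hh : MemLp h 2)
    (hc : ∀ᵐ t, t ∉ latticeCell M c → h t = 0) :
    ∑' k : ι → ℤ, ‖∫ t, (𝐞 ((fun i => (k i : ℝ)) ⬝ᵥ (M *ᵥ t)) : ℂ) * h t‖ₑ ^ 2 =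
      ENNReal.ofReal |M.det|⁻¹ * ∫⁻ t, ‖h t‖ₑ ^ 2 := by
  have hM' := det_inv_ne_zero hM
  have hsupp : ∀ᵐ s, s ∉ unitCube c → h (M⁻¹ *ᵥ s) = 0 := by
    filter_upwards [(quasiMeasurePreserving_mulVec hM').ae hc] with s hs
    rwa [latticeCell, Set.mem_ofPred_eq, mulVec_inv_mulVec hM] at hs
  have hint : ∀ k : ι → ℤ, ∫ t, (𝐞 ((fun i => (k i : ℝ)) ⬝ᵥ (M *ᵥ t)) : ℂ) * h t =
      |M.det|⁻¹ • ∫ s, (𝐞 ((fun i => (k i : ℝ)) ⬝ᵥ s) : ℂ) * h (M⁻¹ *ᵥ s) := fun k => by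
    rw [← integral_comp_mulVec hM]
    simp only [inv_mulVec_mulVec hM]
  have hlint : ∫⁻ t, ‖h t‖ₑ ^ 2 = ENNReal.ofReal |M.det|⁻¹ * ∫⁻ s, ‖h (M⁻¹ *ᵥ s)‖ₑ ^ 2 := by
    rw [← lintegral_comp_mulVec hM]
    simp only [inv_mulVec_mulVec hM]
  simp only [hint, enorm_smul, mul_pow, ENNReal.tsum_mul_left,
    tsum_enorm_sq_integral_of_unitCube c (memLp_comp_mulVec hM' hh) hsupp, hlint,
    Real.enorm_eq_ofReal_abs, abs_inv, abs_abs]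
  rw [← mul_assoc, ← pow_two]

theorem measurableSet_latticeCell (M : Matrix ι ι ℝ) (c : ι → ℝ) :
    MeasurableSet (latticeCell M c) :=
  (measurableSet_unitCube c).preimage
    (continuous_const.matrix_mulVec continuous_id).measurable

theorem volume_latticeCell [DecidableEq ι] {M : Matrix ι ι ℝ} (hM : M.det ≠ 0) (c : ι → ℝ) :
    volume (latticeCell M c) = ENNReal.ofReal |M.det|⁻¹ := by
  have hmap := (measurableEmbedding_mulVec hM).map_apply volume (unitCube c)
  rw [map_mulVec_volume hM, Measure.smul_apply, volume_unitCube, smul_eq_mul, mul_one] at hmap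
  exact hmap.symm

theorem iUnion_latticeCell (M : Matrix ι ι ℝ) :
    ⋃ c : ι → ℤ, latticeCell M (fun i => (c i : ℝ)) = Set.univ := by
  ext t
  simp [latticeCell, mem_unitCube_intCast_iff]

theorem pairwise_disjoint_latticeCell (M : Matrix ι ι ℝ) :
    Pairwise (Function.onFun Disjoint fun c : ι → ℤ => latticeCell M fun i => (c i : ℝ)) := by
  intro c c' hcc'
  rw [Function.onFun, Set.disjoint_left]
  intro t ht ht'
  simp only [latticeCell, Set.mem_ofPred_eq, mem_unitCube_intCast_iff] at ht ht'
  exact hcc' (ht.trans ht'.symm)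

theorem tsum_setLIntegral_latticeCell (M : Matrix ι ι ℝ) (μ : Measure (ι → ℝ))
    (F : (ι → ℝ) → ℝ≥0∞) :
    ∑' c : ι → ℤ, ∫⁻ t in latticeCell M (fun i => (c i : ℝ)), F t ∂μ = ∫⁻ t, F t ∂μ := by
  rw [← lintegral_iUnion (fun _ => measurableSet_latticeCell M _)
    (pairwise_disjoint_latticeCell M), iUnion_latticeCell, Measure.restrict_univ]

theorem tsum_setLIntegral_sub_mulVec [DecidableEq ι] {A : Matrix ι ι ℝ} (hA : A.det ≠ 0)
    (F : (ι → ℝ) → ℝ≥0∞) :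
    ∑' n : ι → ℤ, ∫⁻ t in latticeCell A⁻¹ 0, F (t - A *ᵥ fun j => (n j : ℝ)) = ∫⁻ t, F t := by
  rw [← tsum_setLIntegral_latticeCell A⁻¹ volume F, ← (Equiv.neg (ι → ℤ)).tsum_eq]
  refine tsum_congr fun n => ?_
  have hcell : ∀ t, t + (A *ᵥ fun j => ((-n) j : ℝ)) ∈ latticeCell A⁻¹ 0 ↔
      t ∈ latticeCell A⁻¹ fun i => (n i : ℝ) := fun t => by
    simp only [latticeCell, unitCube, Set.mem_ofPred_eq, Matrix.mulVec_add,
      inv_mulVec_mulVec hA, Set.mem_Ioc, Pi.add_apply, Pi.neg_apply, Int.cast_neg, Pi.zero_apply]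
    refine forall_congr' fun i => ?_
    constructor <;> rintro ⟨_, _⟩ <;> constructor <;> linarith
  rw [← lintegral_indicator (measurableSet_latticeCell _ _),
    ← lintegral_indicator (measurableSet_latticeCell _ _), Equiv.neg_apply,
    ← lintegral_add_right_eq_self _ (A *ᵥ fun j => ((-n) j : ℝ))]
  refine lintegral_congr fun t => ?_
  by_cases ht : t ∈ latticeCell A⁻¹ fun i => (n i : ℝ)
  · rw [Set.indicator_of_mem ht, Set.indicator_of_mem ((hcell t).2 ht), add_sub_cancel_right]
  · rw [Set.indicator_of_notMem ht, Set.indicator_of_notMem (mt (hcell t).1 ht)]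

end FourierSeries

/-! ### The density of a Gabor Parseval frame -/

section GaborDensity

variable {d : ℕ} {g : L2R d} {A B : Matrix (Fin d) (Fin d) ℝ}

theorem coeFn_timeFreq (ω x : Fin d → ℝ) (F : L2R d) :
    timeFreq ω x F =ᵐ[volume] fun t => 𝐞 (t ⬝ᵥ ω) * F (t - x) :=
  MemLp.coeFn_toLp _

theorem inner_indicatorConstLp_gaborSystem {E : Set (Fin d → ℝ)} (hE : MeasurableSet E)
    (hEfin : volume E ≠ ∞) (k n : Fin d → ℤ) :
    inner ℂ (indicatorConstLp 2 hE hEfin (1 : ℂ)) (gaborSystem g A B (k, n)) =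
      ∫ t, 𝐞 ((fun i => (k i : ℝ)) ⬝ᵥ (Bᵀ *ᵥ t)) *
        E.indicator (fun t => g (t - A *ᵥ fun j => (n j : ℝ))) t := by
  rw [L2.inner_indicatorConstLp_one hE hEfin, ← integral_indicator hE]
  refine integral_congr_ae ?_
  filter_upwards [coeFn_timeFreq (B *ᵥ fun j => (k j : ℝ)) (A *ᵥ fun j => (n j : ℝ)) g] with t ht
  by_cases htE : t ∈ E
  · simp only [gaborSystem, Set.indicator_of_mem htE, ht]
    rw [Matrix.mulVec_transpose, Matrix.dotProduct_mulVec, dotProduct_comm]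
  · simp only [Set.indicator_of_notMem htE, mul_zero]

theorem tsum_enorm_sq_inner_gaborSystem (hB : B.det ≠ 0) {E : Set (Fin d → ℝ)}
    (hE : MeasurableSet E) (hEfin : volume E ≠ ∞) {c : Fin d → ℝ} (hEc : E ⊆ latticeCell Bᵀ c)
    (n : Fin d → ℤ) :
    ∑' k : Fin d → ℤ,
        ‖inner ℂ (indicatorConstLp 2 hE hEfin (1 : ℂ)) (gaborSystem g A B (k, n))‖ₑ ^ 2 =
      ENNReal.ofReal |B.det|⁻¹ * ∫⁻ t in E, ‖g (t - A *ᵥ fun j => (n j : ℝ))‖ₑ ^ 2 := by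
  set x : Fin d → ℝ := A *ᵥ fun j => (n j : ℝ)
  have hg : MemLp (fun t => g (t - x)) 2 volume :=
    (Lp.memLp g).comp_measurePreserving (measurePreserving_sub_right volume x)
  simp only [inner_indicatorConstLp_gaborSystem]
  rw [tsum_enorm_sq_integral_of_latticeCell (by rwa [Matrix.det_transpose]) c (hg.indicator hE)
    (Filter.Eventually.of_forall fun t ht => Set.indicator_of_notMem (fun htE => ht (hEc htE)) _),
    Matrix.det_transpose, ← lintegral_indicator hE]
  congr 2 with t
  by_cases htE : t ∈ E <;> simp [htE, x]

theorem tsum_setLIntegral_of_subset_latticeCell (hB : B.det ≠ 0)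
    (h : IsParsevalFrame (gaborSystem g A B) ⊤) {E : Set (Fin d → ℝ)} (hE : MeasurableSet E)
    {c : Fin d → ℝ} (hEc : E ⊆ latticeCell Bᵀ c) :
    ∑' n : Fin d → ℤ, ENNReal.ofReal |B.det|⁻¹ *
      ∫⁻ t in E, ‖g (t - A *ᵥ fun j => (n j : ℝ))‖ₑ ^ 2 = volume E := by
  have hEfin : volume E ≠ ∞ := by
    refine ne_top_of_le_ne_top ?_ (measure_mono hEc)
    rw [volume_latticeCell (by rwa [Matrix.det_transpose])]
    exact ENNReal.ofReal_ne_top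
  have hframe := (hasSum_norm_sq_iff (by positivity)).1
    (h.2 (indicatorConstLp 2 hE hEfin (1 : ℂ)) Submodule.mem_top)
  have hnorm : ENNReal.ofReal (‖indicatorConstLp 2 hE hEfin (1 : ℂ)‖ ^ 2) = volume E := by
    rw [norm_indicatorConstLp two_ne_zero ENNReal.ofNat_ne_top, norm_one, one_mul,
      ← Real.rpow_natCast, ← Real.rpow_mul measureReal_nonneg]
    simp [measureReal_def, ENNReal.ofReal_toReal hEfin]
  rw [hnorm, ENNReal.tsum_prod', ENNReal.tsum_comm] at hframe
  simpa only [tsum_enorm_sq_inner_gaborSystem hB hE hEfin hEc] using hframe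

theorem tsum_setLIntegral_of_isParsevalFrame (hB : B.det ≠ 0)
    (h : IsParsevalFrame (gaborSystem g A B) ⊤) {E : Set (Fin d → ℝ)} (hE : MeasurableSet E) :
    ∑' n : Fin d → ℤ, ENNReal.ofReal |B.det|⁻¹ *
      ∫⁻ t in E, ‖g (t - A *ᵥ fun j => (n j : ℝ))‖ₑ ^ 2 = volume E := by
  have hcell := fun c => measurableSet_latticeCell (Bᵀ) c
  calc ∑' n : Fin d → ℤ, ENNReal.ofReal |B.det|⁻¹ *
        ∫⁻ t in E, ‖g (t - A *ᵥ fun j => (n j : ℝ))‖ₑ ^ 2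
      = ∑' (c : Fin d → ℤ) (n : Fin d → ℤ), ENNReal.ofReal |B.det|⁻¹ *
          ∫⁻ t in latticeCell Bᵀ (fun i => (c i : ℝ)) ∩ E,
            ‖g (t - A *ᵥ fun j => (n j : ℝ))‖ₑ ^ 2 := by
        rw [ENNReal.tsum_comm]
        refine tsum_congr fun n => ?_
        rw [ENNReal.tsum_mul_left, ← tsum_setLIntegral_latticeCell Bᵀ (volume.restrict E)]
        simp only [Measure.restrict_restrict (hcell _)]
    _ = ∑' c : Fin d → ℤ, volume (latticeCell Bᵀ (fun i => (c i : ℝ)) ∩ E) :=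
        tsum_congr fun c => tsum_setLIntegral_of_subset_latticeCell hB h ((hcell _).inter hE)
          Set.inter_subset_left
    _ = volume E := by
        simpa [Measure.restrict_apply (hcell _)] using
          tsum_setLIntegral_latticeCell Bᵀ (volume.restrict E) 1

/-- The density theorem for Gabor frames: average the pointwise identity
`∑ₙ |det B|⁻¹ |g(t - An)|² = 1` over a cell of the lattice `Aℤᵈ`. -/
theorem enorm_sq_of_isParsevalFrame_gaborSystem (hA : A.det ≠ 0) (hB : B.det ≠ 0)
    (h : IsParsevalFrame (gaborSystem g A B) ⊤) :
    ‖g‖ₑ ^ 2 = ENNReal.ofReal (|A.det| * |B.det|) := by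
  have hcell := tsum_setLIntegral_of_isParsevalFrame hB h (measurableSet_latticeCell A⁻¹ 0)
  rw [ENNReal.tsum_mul_left, tsum_setLIntegral_sub_mulVec hA fun t => ‖g t‖ₑ ^ 2,
    lintegral_enorm_sq_coeFn, volume_latticeCell (det_inv_ne_zero hA), Matrix.det_nonsing_inv,
    Ring.inverse_eq_inv', abs_inv, inv_inv] at hcell
  have hpos : 0 < |B.det| := abs_pos.2 hB
  rw [mul_comm, ENNReal.ofReal_mul (abs_nonneg _), ← hcell, ← mul_assoc,
    ← ENNReal.ofReal_mul (abs_nonneg _), mul_inv_cancel₀ hpos.ne', ENNReal.ofReal_one, one_mul]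

end GaborDensity

/-! ### The Plancherel theorem for functions -/

theorem coeFn_fourier_toLp {V E : Type*} [NormedAddCommGroup V] [InnerProductSpace ℝ V]
    [FiniteDimensional ℝ V] [MeasurableSpace V] [BorelSpace V] [NormedAddCommGroup E]
    [InnerProductSpace ℂ E] [CompleteSpace E] {f : V → E} (hf : Integrable f) (hf2 : MemLp f 2) :
    (𝓕 (hf2.toLp f) : Lp E 2 (volume : Measure V)) =ᵐ[volume] 𝓕 f := by
  have hcont : Continuous (𝓕 f) :=
    VectorFourier.fourierIntegral_continuous Real.continuous_fourierChar continuous_inner hf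
  refine ae_eq_of_integral_contDiff_smul_eq ((Lp.memLp _).locallyIntegrable (by norm_num))
    hcont.locallyIntegrable fun g hg hgc => ?_
  have hgc' : HasCompactSupport fun x => (g x : ℂ) :=
    hgc.comp_left (g := fun x : ℝ => (x : ℂ)) Complex.ofReal_zero
  let G : SchwartzMap V ℂ := hgc'.toSchwartzMap (Complex.ofRealCLM.contDiff.comp hg)
  have hdist := congrArg (fun T => T G) (Lp.fourier_toTemperedDistribution_eq (hf2.toLp f))
  simp only [TemperedDistribution.fourier_apply, Lp.toTemperedDistribution_apply] at hdist
  calc ∫ x, g x • (𝓕 (hf2.toLp f) : Lp E 2 (volume : Measure V)) x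
      = ∫ x, G x • (𝓕 (hf2.toLp f) : Lp E 2 (volume : Measure V)) x := rfl
    _ = ∫ x, 𝓕 G x • hf2.toLp f x := hdist.symm
    _ = ∫ x, 𝓕 (G : V → ℂ) x • f x := integral_congr_ae <| by
        filter_upwards [hf2.coeFn_toLp] with x hx
        rw [hx, SchwartzMap.fourier_coe]
    _ = ∫ x, G x • 𝓕 f x := by
        have := VectorFourier.integral_fourierIntegral_smul_eq_flip (μ := (volume : Measure V))
          (ν := (volume : Measure V)) (L := innerₗ V) Real.continuous_fourierChar
          continuous_inner G.integrable hf
        rwa [flip_innerₗ] at this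
    _ = ∫ x, g x • 𝓕 f x := rfl

theorem lintegral_enorm_sq_fourier {V E : Type*} [NormedAddCommGroup V] [InnerProductSpace ℝ V]
    [FiniteDimensional ℝ V] [MeasurableSpace V] [BorelSpace V] [NormedAddCommGroup E]
    [InnerProductSpace ℂ E] [CompleteSpace E] {f : V → E} (hf : Integrable f) (hf2 : MemLp f 2) :
    ∫⁻ w, ‖𝓕 f w‖ₑ ^ 2 = ∫⁻ v, ‖f v‖ₑ ^ 2 := by
  calc ∫⁻ w, ‖𝓕 f w‖ₑ ^ 2 = ∫⁻ w, ‖(𝓕 (hf2.toLp f) : Lp E 2 (volume : Measure V)) w‖ₑ ^ 2 :=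
        lintegral_congr_ae <| by
          filter_upwards [coeFn_fourier_toLp hf hf2] with w hw
          rw [hw]
    _ = ∫⁻ v, ‖f v‖ₑ ^ 2 := by
        rw [lintegral_enorm_sq_coeFn, ← ofReal_norm, Lp.norm_fourier_eq, ofReal_norm,
          Lp.enorm_toLp, lintegral_enorm_sq_eq_eLpNorm_sq]

theorem lintegral_enorm_sq_integral_fourierChar_pi {ι E : Type*} [Fintype ι]
    [NormedAddCommGroup E] [InnerProductSpace ℂ E] [CompleteSpace E] {f : (ι → ℝ) → E}
    (hf : Integrable f) (hf2 : MemLp f 2) :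
    ∫⁻ w : ι → ℝ, ‖∫ v, 𝐞 (w ⬝ᵥ v) • f v‖ₑ ^ 2 = ∫⁻ v, ‖f v‖ₑ ^ 2 := by
  have hp := PiLp.volume_preserving_ofLp ι
  have he := (MeasurableEquiv.toLp 2 (ι → ℝ)).symm.measurableEmbedding
  have h := lintegral_enorm_sq_fourier (V := EuclideanSpace ℝ ι) (f := fun v => f v.ofLp)
    (hp.integrable_comp_of_integrable hf) (hf2.comp_measurePreserving hp)
  rw [← hp.lintegral_comp_emb he fun v => ‖f v‖ₑ ^ 2, ← h, ← lintegral_neg_eq_self,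
    ← hp.lintegral_comp_emb he]
  refine lintegral_congr fun w => ?_
  rw [Real.fourier_eq, ← hp.integral_comp he]
  simp only [PiLp.inner_apply, dotProduct, Pi.neg_apply, neg_mul, Finset.sum_neg_distrib,
    RCLike.inner_apply, conj_trivial]

theorem lintegral_enorm_sq_integral_fourierChar_prod {ι κ E : Type*} [Fintype ι] [Fintype κ]
    [NormedAddCommGroup E] [InnerProductSpace ℂ E] [CompleteSpace E]
    {f : (ι → ℝ) × (κ → ℝ) → E} (hf : Integrable f) (hf2 : MemLp f 2) :
    ∫⁻ w : (ι → ℝ) × (κ → ℝ), ‖∫ v, 𝐞 (w.1 ⬝ᵥ v.1 + w.2 ⬝ᵥ v.2) • f v‖ₑ ^ 2 =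
      ∫⁻ v, ‖f v‖ₑ ^ 2 := by
  have hp := volume_measurePreserving_sumPiEquivProdPi (fun _ : ι ⊕ κ => ℝ)
  have he := (MeasurableEquiv.sumPiEquivProdPi (fun _ : ι ⊕ κ => ℝ)).measurableEmbedding
  have h := lintegral_enorm_sq_integral_fourierChar_pi
    (hp.integrable_comp_of_integrable hf) (hf2.comp_measurePreserving hp)
  rw [← hp.lintegral_comp_emb he, ← hp.lintegral_comp_emb he fun v => ‖f v‖ₑ ^ 2]
  simp only [Function.comp_apply] at h
  rw [← h]
  refine lintegral_congr fun w => ?_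
  rw [← hp.integral_comp he]
  simp [dotProduct, MeasurableEquiv.sumPiEquivProdPi, Equiv.sumPiEquivProdPi]

/-! ### The matrices `B(λ)` -/

namespace NilpotentAlgebra

variable {p d : ℕ} {𝔫 : Type*} [LieRing 𝔫] [LieAlgebra ℝ 𝔫] (D : NilpotentAlgebra p d 𝔫)

theorem B_add (l m : Fin p → ℝ) : D.B (l + m) = D.B l + D.B m := by
  ext i j
  simp [B, functional, add_mul, Finset.sum_add_distrib, add_comm]

theorem B_smul (c : ℝ) (l : Fin p → ℝ) : D.B (c • l) = c • D.B l := by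
  ext i j
  simp [B, functional, Finset.mul_sum, mul_assoc]

@[fun_prop]
theorem continuous_B : Continuous D.B :=
  (IsLinearMap.mk' D.B ⟨D.B_add, D.B_smul⟩).continuous_of_finiteDimensional

@[fun_prop]
theorem continuous_det_B : Continuous fun l => (D.B l).det := D.continuous_B.matrix_det

theorem measurableSet_crossSection : MeasurableSet D.crossSection :=
  (isOpen_ne_fun D.continuous_det_B continuous_const).measurableSet

theorem functional_eq_dotProduct_coordZ (l : Fin p → ℝ) (v : 𝔫) :
    D.functional l v = l ⬝ᵥ D.coordZ v := by
  simp [functional, coordZ, dotProduct]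

theorem functional_lie_sumX_sumY (l : Fin p → ℝ) (x y : Fin d → ℝ) :
    D.functional l ⁅D.sumX x, D.sumY y⁆ = -(x ⬝ᵥ (D.B l *ᵥ y)) := by
  simp only [sumX, sumY, sum_lie, lie_sum, smul_lie, lie_smul, map_sum, map_smul, dotProduct,
    Matrix.mulVec, B, Matrix.of_apply, smul_eq_mul, Finset.mul_sum, neg_mul, mul_neg,
    Finset.sum_neg_distrib, neg_neg]
  rw [Finset.sum_comm]
  exact Finset.sum_congr rfl fun i _ => Finset.sum_congr rfl fun j _ => by ring

theorem functional_comp_Z_lie (ℓ : 𝔫 →ₗ[ℝ] ℝ) (v w : 𝔫) :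
    D.functional (fun k => ℓ (D.Z k)) ⁅v, w⁆ = ℓ ⁅v, w⁆ := by
  conv_rhs => rw [← ExpGroup.sumZ_coordZ_lie (D := D)]
  simp [functional_eq_dotProduct_coordZ, sumZ, dotProduct, mul_comm]

theorem crossSection_nonempty : D.crossSection.Nonempty := by
  obtain ⟨ℓ, hℓ⟩ := D.exists_stabilizer_eq_center
  refine ⟨fun k => ℓ (D.Z k), fun hdet => ?_⟩
  obtain ⟨y, hy0, hy⟩ := Matrix.exists_mulVec_eq_zero_iff.2 hdet
  have hcenter : D.sumY y ∈ LieAlgebra.center ℝ 𝔫 := hℓ _ fun v => by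
    rw [← ExpGroup.sum_coord (D := D) v, lie_add, lie_add, ExpGroup.lie_sumZ,
      ExpGroup.lie_sumY_sumY, zero_add, zero_add, ← lie_skew, map_neg, ← functional_comp_Z_lie D,
      functional_lie_sumX_sumY, hy, dotProduct_zero, neg_zero, neg_zero]
  rw [← LieSubmodule.mem_toSubmodule, D.center_eq_span] at hcenter
  refine hy0 ?_
  rw [← ExpGroup.coordY_sumY (D := D) y]
  refine Submodule.span_le (p := LinearMap.ker D.coordY) |>.2 ?_ hcenter
  rintro _ ⟨k, rfl⟩
  ext j
  simp [coordY]

theorem ae_mem_crossSection : ∀ᵐ l, l ∈ D.crossSection := by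
  obtain ⟨l₀, hl₀⟩ := D.crossSection_nonempty
  refine ae_mem_of_ae_add_linearMap_mem ((LinearMap.id : ℝ →ₗ[ℝ] ℝ).smulRight l₀) volume volume
    D.measurableSet_crossSection fun l => ?_
  -- On the line `l + ℝ l₀` the determinant is a polynomial with leading coefficient `det B(l₀)`.
  let P : Polynomial ℝ := ((Polynomial.X : Polynomial ℝ) • (D.B l₀).map Polynomial.C +
    (D.B l).map Polynomial.C).det
  have hP : P ≠ 0 := fun hP => hl₀ <| by
    rw [← Polynomial.coeff_det_X_add_C_card (D.B l₀) (D.B l)]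
    exact (congrArg (Polynomial.coeff · _) hP).trans (Polynomial.coeff_zero _)
  have hPeval (t : ℝ) : P.eval t = (D.B (l + t • l₀)).det := by
    rw [← Polynomial.coe_evalRingHom t, RingHom.map_det, B_add, B_smul]
    congr 1
    ext i j
    simp [add_comm, mul_comm t]
  refine measure_mono_null (fun t ht => ?_)
    ((Polynomial.finite_setOfPred_isRoot hP).measure_zero volume)
  exact (hPeval t).trans (not_not.1 ht)

end NilpotentAlgebra

/-! ### Pointwise isometries and modulations -/

section PointwiseIsometry

variable {α 𝕜 E F : Type*} [MeasurableSpace α] {μ : Measure α} [NormedField 𝕜]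
  [NormedAddCommGroup E] [NormedSpace 𝕜 E] [NormedAddCommGroup F] [NormedSpace 𝕜 F]

theorem memLp_linearIsometry_apply {p : ℝ≥0∞} {U : α → E →ₗᵢ[𝕜] F} {f : Lp E p μ}
    (hU : AEStronglyMeasurable (fun a => U a (f a)) μ) : MemLp (fun a => U a (f a)) p μ :=
  (Lp.memLp f).congr_norm hU (.of_forall fun a => ((U a).norm_map _).symm)

/-- The isometry `(U f)(a) = U a (f a)` of `Lᵖ` spaces given by a measurable field `U` of
isometries. Measurability of the field is asked for in its strong form: `U` maps (classes of)
`Lᵖ` functions to measurable functions. -/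
def pointwiseIsometry {p : ℝ≥0∞} [Fact (1 ≤ p)] (U : α → E →ₗᵢ[𝕜] F)
    (hU : ∀ f : Lp E p μ, AEStronglyMeasurable (fun a => U a (f a)) μ) :
    Lp E p μ →ₗᵢ[𝕜] Lp F p μ where
  toFun f := (memLp_linearIsometry_apply (hU f)).toLp _
  map_add' f g := by
    rw [← MemLp.toLp_add]
    refine MemLp.toLp_congr _ _ ?_
    filter_upwards [Lp.coeFn_add f g] with a ha
    rw [ha, Pi.add_apply, map_add, Pi.add_apply]
  map_smul' c f := by
    rw [RingHom.id_apply, ← MemLp.toLp_const_smul]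
    refine MemLp.toLp_congr _ _ ?_
    filter_upwards [Lp.coeFn_smul c f] with a ha
    rw [ha, Pi.smul_apply, map_smul, Pi.smul_apply]
  norm_map' f := by
    change ‖(memLp_linearIsometry_apply (hU f)).toLp _‖ = ‖f‖
    rw [Lp.norm_toLp, Lp.norm_def]
    exact congrArg _ (eLpNorm_congr_norm_ae (.of_forall fun a => (U a).norm_map _))

theorem coeFn_pointwiseIsometry {p : ℝ≥0∞} [Fact (1 ≤ p)] {U : α → E →ₗᵢ[𝕜] F}
    (hU : ∀ f : Lp E p μ, AEStronglyMeasurable (fun a => U a (f a)) μ) (f : Lp E p μ) :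
    pointwiseIsometry U hU f =ᵐ[μ] fun a => U a (f a) :=
  MemLp.coeFn_toLp (memLp_linearIsometry_apply (hU f))

theorem tendsto_Lp_two_of_dominated {f : ℕ → Lp E 2 μ} {g : Lp E 2 μ} {b : α → ℝ≥0∞}
    (hb : ∫⁻ a, b a ^ 2 ∂μ ≠ ∞) (hfb : ∀ n, ∀ᵐ a ∂μ, ‖f n a - g a‖ₑ ≤ b a)
    (hfg : ∀ᵐ a ∂μ, Filter.Tendsto (fun n => f n a) Filter.atTop (nhds (g a))) :
    Filter.Tendsto f Filter.atTop (nhds g) := by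
  have hint : Filter.Tendsto (fun n => ∫⁻ a, ‖f n a - g a‖ₑ ^ 2 ∂μ) Filter.atTop (nhds 0) := by
    rw [← lintegral_zero (μ := μ)]
    refine tendsto_lintegral_of_dominated_convergence' (fun a => b a ^ 2)
      (fun n => ((Lp.aestronglyMeasurable _).sub (Lp.aestronglyMeasurable _)).enorm.pow_const 2)
      (fun n => (hfb n).mono fun a ha => pow_le_pow_left₀ zero_le ha 2) hb ?_
    filter_upwards [hfg] with a ha
    have hsub : Filter.Tendsto (fun n => f n a - g a) Filter.atTop (nhds 0) := by
      simpa using ha.sub_const (g a)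
    simpa [Function.comp_def] using
      (((ENNReal.continuous_pow 2).comp continuous_enorm).tendsto (0 : E)).comp hsub
  have hsq (n : ℕ) : ∫⁻ a, ‖f n a - g a‖ₑ ^ 2 ∂μ = edist (f n) g ^ 2 := by
    rw [edist_eq_enorm_sub, ← lintegral_enorm_sq_coeFn]
    refine lintegral_congr_ae ?_
    filter_upwards [Lp.coeFn_sub (f n) g] with a ha
    rw [ha, Pi.sub_apply]
  simp only [hsq] at hint
  rw [tendsto_iff_edist_tendsto_0]
  have hroot := ((ENNReal.continuous_rpow_const (y := (1 / 2 : ℝ))).tendsto 0).comp hint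
  rw [ENNReal.zero_rpow_of_pos (by norm_num)] at hroot
  refine hroot.congr fun n => ?_
  rw [Function.comp_apply, ← ENNReal.rpow_natCast, ← ENNReal.rpow_mul]
  norm_num

theorem continuous_uncurry_pointwiseIsometry {Λ : Type*} [TopologicalSpace Λ]
    [FirstCountableTopology Λ] {U : Λ → α → E →ₗᵢ[𝕜] F}
    (hU : ∀ l, ∀ f : Lp E 2 μ, AEStronglyMeasurable (fun a => U l a (f a)) μ)
    (hc : ∀ a v, Continuous fun l => U l a v) :
    Continuous fun x : Λ × Lp E 2 μ => pointwiseIsometry (U x.1) (hU x.1) x.2 := by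
  refine continuous_prod_of_continuous_lipschitzWith' _ 1
    (fun l => (pointwiseIsometry (U l) (hU l)).lipschitz) fun f => ?_
  refine continuous_iff_continuousAt.2 fun l₀ =>
    Filter.tendsto_of_seq_tendsto fun l hl => ?_
  refine tendsto_Lp_two_of_dominated (b := fun a => 2 * ‖f a‖ₑ) ?_ (fun n => ?_) ?_
  · simp only [mul_pow]
    rw [lintegral_const_mul' _ _ (by norm_num), lintegral_enorm_sq_coeFn]
    finiteness
  · filter_upwards [coeFn_pointwiseIsometry (hU (l n)) f, coeFn_pointwiseIsometry (hU l₀) f]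
      with a h1 h2
    rw [Function.comp_apply, h1, h2, two_mul]
    refine enorm_sub_le.trans (le_of_eq ?_)
    rw [LinearIsometry.enorm_map, LinearIsometry.enorm_map]
  · filter_upwards [ae_all_iff.2 fun n => coeFn_pointwiseIsometry (hU (l n)) f,
      coeFn_pointwiseIsometry (hU l₀) f] with a h1 h2
    simp only [Function.comp_apply, h1, h2]
    exact ((hc a (f a)).tendsto l₀).comp hl

end PointwiseIsometry

section Modulation

variable {α : Type*} [MeasurableSpace α] {μ : Measure α}

/-- Multiplication by a complex number of modulus one. -/
def mulCircle (z : Circle) : ℂ →ₗᵢ[ℂ] ℂ :=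
  ⟨LinearMap.mulLeft ℂ (z : ℂ), fun v => by simp [Circle.norm_coe]⟩

theorem aestronglyMeasurable_mulCircle_fourierChar {θ : α → ℝ} (hθ : Measurable θ)
    (f : Lp ℂ 2 μ) : AEStronglyMeasurable (fun a => mulCircle (𝐞 (θ a)) (f a)) μ :=
  ((continuous_subtype_val.comp Real.continuous_fourierChar).measurable.comp
    hθ).aestronglyMeasurable.mul (Lp.aestronglyMeasurable f)

/-- Multiplication of `L²` functions by `e^{2πiθ}`, for a measurable phase `θ`. -/
def modulation {θ : α → ℝ} (hθ : Measurable θ) : Lp ℂ 2 μ →ₗᵢ[ℂ] Lp ℂ 2 μ :=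
  pointwiseIsometry (fun a => mulCircle (𝐞 (θ a))) (aestronglyMeasurable_mulCircle_fourierChar hθ)

theorem coeFn_modulation {θ : α → ℝ} (hθ : Measurable θ) (f : Lp ℂ 2 μ) :
    modulation hθ f =ᵐ[μ] fun a => 𝐞 (θ a) * f a :=
  coeFn_pointwiseIsometry _ f

theorem continuous_uncurry_modulation {Λ : Type*} [TopologicalSpace Λ] [FirstCountableTopology Λ]
    {θ : Λ → α → ℝ} (hθ : ∀ l, Measurable (θ l)) (hc : ∀ a, Continuous fun l => θ l a) :
    Continuous fun x : Λ × Lp ℂ 2 μ => modulation (hθ x.1) x.2 :=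
  continuous_uncurry_pointwiseIsometry
    (fun l => aestronglyMeasurable_mulCircle_fourierChar (hθ l)) fun a _ =>
      (continuous_subtype_val.comp (Real.continuous_fourierChar.comp (hc a))).mul continuous_const

end Modulation

/-! ### Rank one operators -/

theorem coeFn_tensor {d : ℕ} (f u : L2R d) :
    tensor f u =ᵐ[volume] fun s => f s.1 * (starRingEnd ℂ) (u s.2) :=
  MemLp.coeFn_toLp _

theorem inner_tensor_tensor {d : ℕ} (f g u v : L2R d) :
    inner ℂ (tensor f u) (tensor g v) = inner ℂ f g * inner ℂ v u := by
  rw [L2.inner_def, L2.inner_def, L2.inner_def, ← integral_prod_mul]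
  refine integral_congr_ae ?_
  filter_upwards [coeFn_tensor f u, coeFn_tensor g v] with s h1 h2
  rw [h1, h2]
  simp only [RCLike.inner_apply, map_mul, RCLike.conj_conj]
  ring

theorem norm_tensor {d : ℕ} (f u : L2R d) : ‖tensor f u‖ = ‖f‖ * ‖u‖ := by
  have h := inner_tensor_tensor f f u u
  simp only [inner_self_eq_norm_sq_to_K] at h
  refine (pow_left_inj₀ (norm_nonneg _) (by positivity) two_ne_zero).1 ?_
  rw [mul_pow]
  exact_mod_cast h

/-! ### The representations `π_λ` and `π_λ ⊗ 1` -/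

namespace ExpGroup

variable {p d : ℕ} {𝔫 : Type*} [LieRing 𝔫] [LieAlgebra ℝ 𝔫] (D : NilpotentAlgebra p d 𝔫)

/-- The phase `⟨λ, z⟩ + ⟨t, B(λ) y⟩` by which `π_λ(n)` modulates, where `(z, y, x)` are the
coordinates of `n`. -/
def phase (n : ExpGroup D) (l : Fin p → ℝ) (t : Fin d → ℝ) : ℝ :=
  l ⬝ᵥ (coords D n).1 + t ⬝ᵥ (D.B l *ᵥ (coords D n).2.1)

@[fun_prop]
theorem continuous_uncurry_phase (n : ExpGroup D) :
    Continuous fun x : (Fin p → ℝ) × (Fin d → ℝ) => phase D n x.1 x.2 := by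
  unfold phase
  fun_prop

@[fun_prop]
theorem measurable_phase (n : ExpGroup D) (l : Fin p → ℝ) : Measurable (phase D n l) :=
  ((continuous_uncurry_phase D n).comp (Continuous.prodMk_right l)).measurable

/-- The isometry `π_λ(n)`, bundled (see `repIsometry_apply`). -/
def repIsometry (l : Fin p → ℝ) (n : ExpGroup D) : L2R d →ₗᵢ[ℂ] L2R d :=
  (modulation (measurable_phase D n l)).comp
    (Lp.compMeasurePreservingₗᵢ ℂ _ (measurePreserving_sub_right volume (coords D n).2.2))

theorem coeFn_repIsometry (l : Fin p → ℝ) (n : ExpGroup D) (F : L2R d) :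
    repIsometry D l n F =ᵐ[volume] fun t => 𝐞 (phase D n l t) * F (t - (coords D n).2.2) := by
  have hshift := measurePreserving_sub_right volume (coords D n).2.2
  filter_upwards [coeFn_modulation (measurable_phase D n l) (Lp.compMeasurePreserving _ hshift F),
    Lp.coeFn_compMeasurePreserving F hshift] with t h1 h2
  exact h1.trans (congrArg _ h2)

theorem repIsometry_apply (l : Fin p → ℝ) (n : ExpGroup D) (F : L2R d) :
    repIsometry D l n F = rep D l n F := by
  refine Lp.ext ?_
  filter_upwards [coeFn_repIsometry D l n F,
    Lp.coeFn_smul (𝐞 (l ⬝ᵥ (coords D n).1) : ℂ)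
      (timeFreq (D.B l *ᵥ (coords D n).2.1) (coords D n).2.2 F),
    coeFn_timeFreq (D.B l *ᵥ (coords D n).2.1) (coords D n).2.2 F] with t h1 h2 h3
  refine h1.trans (Eq.trans ?_ h2.symm)
  rw [Pi.smul_apply, h3, phase, AddChar.map_add_eq_mul, Circle.coe_mul, smul_eq_mul, mul_assoc]

theorem norm_rep (l : Fin p → ℝ) (n : ExpGroup D) (F : L2R d) : ‖rep D l n F‖ = ‖F‖ := by
  rw [← repIsometry_apply, LinearIsometry.norm_map]

theorem inner_rep_rep (l : Fin p → ℝ) (n : ExpGroup D) (F G : L2R d) :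
    inner ℂ (rep D l n F) (rep D l n G) = inner ℂ F G := by
  rw [← repIsometry_apply, ← repIsometry_apply, LinearIsometry.inner_map_map]

theorem coeFn_rep (l : Fin p → ℝ) (n : ExpGroup D) (F : L2R d) :
    rep D l n F =ᵐ[volume] fun t => 𝐞 (phase D n l t) * F (t - (coords D n).2.2) := by
  rw [← repIsometry_apply]
  exact coeFn_repIsometry D l n F

theorem phase_mul (g h : ExpGroup D) (l : Fin p → ℝ) (t : Fin d → ℝ) :
    phase D (g * h) l t = phase D g l t + phase D h l (t - (coords D g).2.2) := by
  simp only [phase, coords_mul, dotProduct_add, ← D.functional_eq_dotProduct_coordZ,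
    D.functional_lie_sumX_sumY, Matrix.mulVec_add, sub_dotProduct]
  ring

theorem rep_mul (l : Fin p → ℝ) (g h : ExpGroup D) (F : L2R d) :
    rep D l (g * h) F = rep D l g (rep D l h F) := by
  refine Lp.ext ?_
  filter_upwards [coeFn_rep D l (g * h) F, coeFn_rep D l g (rep D l h F),
    (measurePreserving_sub_right volume (coords D g).2.2).quasiMeasurePreserving.ae
      (coeFn_rep D l h F)] with t h1 h2 h3
  rw [h1, h2, h3, ← mul_assoc, ← Circle.coe_mul, ← AddChar.map_add_eq_mul, ← phase_mul,
    coords_mul, sub_sub]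

theorem coords_one : coords D 1 = 0 := by
  simp [coords, log_one, NilpotentAlgebra.sumY]

theorem rep_one (l : Fin p → ℝ) (F : L2R d) : rep D l 1 F = F := by
  refine Lp.ext ?_
  filter_upwards [coeFn_rep D l 1 F] with t ht
  simp [ht, phase, coords_one]

theorem rep_surjective (l : Fin p → ℝ) (n : ExpGroup D) : Function.Surjective (rep D l n) :=
  fun F => ⟨rep D l n⁻¹ F, by rw [← rep_mul, mul_inv_cancel, rep_one]⟩

theorem measurePreserving_sub_fst (x : Fin d → ℝ) :
    MeasurePreserving (fun s : (Fin d → ℝ) × (Fin d → ℝ) => (s.1 - x, s.2)) volume volume :=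
  (measurePreserving_sub_right volume x).prod (.id volume)

/-- The operator `T ↦ π_λ(n) T` on Hilbert–Schmidt operators: `π_λ(n)` acts on the first variable
of the kernel. -/
def repHS (l : Fin p → ℝ) (n : ExpGroup D) : HS d →ₗᵢ[ℂ] HS d :=
  (modulation ((measurable_phase D n l).comp measurable_fst)).comp
    (Lp.compMeasurePreservingₗᵢ ℂ _ (measurePreserving_sub_fst (coords D n).2.2))

theorem coeFn_repHS (l : Fin p → ℝ) (n : ExpGroup D) (k : HS d) :
    repHS D l n k =ᵐ[volume] fun s =>
      𝐞 (phase D n l s.1) * k (s.1 - (coords D n).2.2, s.2) := by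
  have hshift := measurePreserving_sub_fst (coords D n).2.2
  filter_upwards [coeFn_modulation ((measurable_phase D n l).comp measurable_fst)
      (Lp.compMeasurePreserving _ hshift k),
    Lp.coeFn_compMeasurePreserving k hshift] with s h1 h2
  exact h1.trans (congrArg _ h2)

theorem repHS_tensor (l : Fin p → ℝ) (n : ExpGroup D) (f u : L2R d) :
    repHS D l n (tensor f u) = tensor (rep D l n f) u := by
  refine Lp.ext ?_
  filter_upwards [coeFn_repHS D l n (tensor f u), coeFn_tensor (rep D l n f) u,
    (measurePreserving_sub_fst (coords D n).2.2).quasiMeasurePreserving.ae (coeFn_tensor f u),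
    Measure.quasiMeasurePreserving_fst.ae (coeFn_rep D l n f)] with s h1 h2 h3 h4
  rw [h1, h2, h3, h4, mul_assoc]

theorem continuous_uncurry_repHS (n : ExpGroup D) :
    Continuous fun x : (Fin p → ℝ) × HS d => repHS D x.1 n x.2 :=
  (continuous_uncurry_modulation (fun l => (measurable_phase D n l).comp measurable_fst)
    fun s => (continuous_uncurry_phase D n).comp (Continuous.prodMk_left s.1)).comp
    (continuous_fst.prodMk ((LinearIsometry.continuous _).comp continuous_snd))

theorem aestronglyMeasurable_repHS (n : ExpGroup D) (Φ : DirectIntegral D) :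
    AEStronglyMeasurable (fun l => repHS D l n (Φ l)) D.plancherelMeasure :=
  Continuous.comp_aestronglyMeasurable (g := fun x : (Fin p → ℝ) × HS d => repHS D x.1 n x.2)
    (f := fun l => (l, Φ l)) (continuous_uncurry_repHS D n)
    (aestronglyMeasurable_id.prodMk (Lp.aestronglyMeasurable Φ))

/-- The operator `∫^⊕ π_λ(n) ⊗ 1 dμ(λ)` on the direct integral. -/
def repField (n : ExpGroup D) : DirectIntegral D →ₗᵢ[ℂ] DirectIntegral D :=
  pointwiseIsometry (fun l => repHS D l n) (aestronglyMeasurable_repHS D n)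

theorem coeFn_repField (n : ExpGroup D) (Φ : DirectIntegral D) :
    repField D n Φ =ᵐ[D.plancherelMeasure] fun l => repHS D l n (Φ l) :=
  coeFn_pointwiseIsometry _ Φ

theorem coeFn_leftRegular (γ : ExpGroup D) (φ : L2N D) :
    leftRegular D γ φ =ᵐ[haar D] fun n => φ (γ⁻¹ * n) :=
  Lp.coeFn_compMeasurePreserving φ (measurePreserving_mul_left D γ⁻¹)

theorem isFourierAt_leftRegular {φ : L2N D} {l : Fin p → ℝ} {k : HS d}
    (h : IsFourierAt D φ l k) (γ : ExpGroup D) :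
    IsFourierAt D (leftRegular D γ φ) l (repHS D l γ k) := by
  intro f f'
  obtain ⟨f'', rfl⟩ := rep_surjective D l γ f'
  have hγ : MeasurableEmbedding fun n => γ * n :=
    MeasurableEquiv.measurableEmbedding ⟨Equiv.mulLeft γ,
      (measurePreserving_mul_left D γ).measurable, (measurePreserving_mul_left D γ⁻¹).measurable⟩
  calc inner ℂ (tensor (rep D l γ f'') f) (repHS D l γ k)
      = ∫ n, φ n * inner ℂ f'' (rep D l n f) ∂haar D := by
        rw [← repHS_tensor, LinearIsometry.inner_map_map, h]
    _ = ∫ n, φ (γ⁻¹ * (γ * n)) * inner ℂ (rep D l γ f'') (rep D l (γ * n) f) ∂haar D := by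
        simp only [inv_mul_cancel_left, rep_mul, inner_rep_rep]
    _ = ∫ n, φ (γ⁻¹ * n) * inner ℂ (rep D l γ f'') (rep D l n f) ∂haar D :=
        (measurePreserving_mul_left D γ).integral_comp hγ
          fun n => φ (γ⁻¹ * n) * inner ℂ (rep D l γ f'') (rep D l n f)
    _ = ∫ n, leftRegular D γ φ n * inner ℂ (rep D l γ f'') (rep D l n f) ∂haar D :=
        integral_congr_ae <| by
          filter_upwards [coeFn_leftRegular D γ φ] with n hn
          rw [hn]

theorem mem_fourierGraph_leftRegular (γ : ExpGroup D) {x : L2N D × DirectIntegral D}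
    (hx : x ∈ fourierGraph D) : (leftRegular D γ x.1, repField D γ x.2) ∈ fourierGraph D := by
  refine ⟨?_, ?_⟩
  · exact ((measurePreserving_mul_left D γ⁻¹).integrable_comp_of_integrable hx.1).congr
      (coeFn_leftRegular D γ x.1).symm
  · filter_upwards [hx.2, coeFn_repField D γ x.2] with l h1 h2
    rw [h2]
    exact isFourierAt_leftRegular D h1 γ

theorem isPlancherelTransform_leftRegular {φ : L2N D} {Φ : DirectIntegral D}
    (h : IsPlancherelTransform D φ Φ) (γ : ExpGroup D) :
    IsPlancherelTransform D (leftRegular D γ φ) (repField D γ Φ) := by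
  let T : L2N D × DirectIntegral D →ₗ[ℂ] L2N D × DirectIntegral D :=
    (leftRegular D γ).toLinearMap.prodMap (repField D γ).toLinearMap
  have hT : Continuous T := (leftRegular D γ).continuous.prodMap (repField D γ).continuous
  have hspan : Submodule.span ℂ (fourierGraph D) ≤ (Submodule.span ℂ (fourierGraph D)).comap T :=
    Submodule.span_le.2 fun y hy => Submodule.subset_span (mem_fourierGraph_leftRegular D γ hy)
  exact map_mem_closure (f := T) (s := Submodule.span ℂ (fourierGraph D)) hT h fun _ hy => hspan hy

end ExpGroup

/-! ### The kernel of `π_λ(f)` -/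

theorem ae_eq_zero_of_forall_setIntegral_prod_eq_zero {α β E : Type*} [MeasurableSpace α]
    [MeasurableSpace β] [NormedAddCommGroup E] [NormedSpace ℝ E] [CompleteSpace E]
    {μ : Measure α} {ν : Measure β} {φ : α × β → E} (hφ : Integrable φ (μ.prod ν))
    (h : ∀ s t, MeasurableSet s → MeasurableSet t → ∫ x in s ×ˢ t, φ x ∂μ.prod ν = 0) :
    φ =ᵐ[μ.prod ν] 0 := by
  suffices H : ∀ E, MeasurableSet E → ∫ x in E, φ x ∂μ.prod ν = 0 from
    hφ.ae_eq_zero_of_forall_setIntegral_eq_zero fun E hE _ => H E hE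
  have huniv : ∫ x, φ x ∂μ.prod ν = 0 := by
    simpa only [Set.univ_prod_univ, setIntegral_univ] using h _ _ .univ .univ
  intro E hE
  induction E, hE using MeasurableSpace.induction_on_inter generateFrom_prod.symm
    isPiSystem_prod with
  | empty => exact setIntegral_empty
  | basic E hE =>
    obtain ⟨s, hs, t, ht, rfl⟩ := hE
    exact h s t hs ht
  | compl E hE ih => rw [setIntegral_compl hE hφ, ih, huniv, sub_zero]
  | iUnion E hd hE ih => simp only [integral_iUnion hE hd hφ.integrableOn, ih, tsum_zero]

theorem ae_eq_of_forall_setIntegral_prod_eq {α β E : Type*} [MeasurableSpace α]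
    [MeasurableSpace β] [NormedAddCommGroup E] [NormedSpace ℝ E] [CompleteSpace E]
    {μ : Measure α} {ν : Measure β} [SigmaFinite μ] [SigmaFinite ν] {φ ψ : α × β → E}
    (hφ : ∀ s t, μ s < ∞ → ν t < ∞ → IntegrableOn φ (s ×ˢ t) (μ.prod ν))
    (hψ : ∀ s t, μ s < ∞ → ν t < ∞ → IntegrableOn ψ (s ×ˢ t) (μ.prod ν))
    (h : ∀ s t, MeasurableSet s → MeasurableSet t → μ s < ∞ → ν t < ∞ →
      ∫ x in s ×ˢ t, φ x ∂μ.prod ν = ∫ x in s ×ˢ t, ψ x ∂μ.prod ν) :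
    φ =ᵐ[μ.prod ν] ψ := by
  have hcover : ⋃ n, spanningSets μ n ×ˢ spanningSets ν n = Set.univ := by
    rw [Set.iUnion_prod_of_monotone (monotone_spanningSets μ) (monotone_spanningSets ν),
      iUnion_spanningSets, iUnion_spanningSets, Set.univ_prod_univ]
  rw [← Measure.restrict_univ (μ := μ.prod ν), ← hcover, Filter.EventuallyEq,
    ae_restrict_iUnion_iff]
  intro n
  have hμ := measure_spanningSets_lt_top μ n
  have hν := measure_spanningSets_lt_top ν n
  rw [← Measure.prod_restrict]
  refine Filter.Eventually.mono (ae_eq_zero_of_forall_setIntegral_prod_eq_zero (φ := φ - ψ) ?_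
    fun s t hs ht => ?_) fun x hx => sub_eq_zero.1 hx
  · rw [Measure.prod_restrict]
    exact (hφ _ _ hμ hν).sub (hψ _ _ hμ hν)
  · have hs' := (measure_mono Set.inter_subset_right).trans_lt hμ (a := μ (s ∩ spanningSets μ n))
    have ht' := (measure_mono Set.inter_subset_right).trans_lt hν (a := ν (t ∩ spanningSets ν n))
    rw [← Measure.prod_restrict, Measure.restrict_restrict hs, Measure.restrict_restrict ht,
      Measure.prod_restrict, integral_sub' (hφ _ _ hs' ht') (hψ _ _ hs' ht'), sub_eq_zero]
    exact h _ _ (hs.inter (measurableSet_spanningSets μ n))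
      (ht.inter (measurableSet_spanningSets ν n)) hs' ht'

theorem integrable_fourierChar_smul {α E : Type*} [MeasurableSpace α] [NormedAddCommGroup E]
    [NormedSpace ℂ E] {μ : Measure α} {θ : α → ℝ} (hθ : Measurable θ) {f : α → E}
    (hf : Integrable f μ) : Integrable (fun x => 𝐞 (θ x) • f x) μ :=
  hf.mono ((Real.continuous_fourierChar.comp_aestronglyMeasurable
    hθ.aestronglyMeasurable).smul hf.1) (Filter.Eventually.of_forall fun _ =>
      (Circle.norm_smul _ _).le)

section PartialFourier

variable {ι κ α E : Type*} [Fintype ι] [Fintype κ] [NormedAddCommGroup E] [NormedSpace ℂ E]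

/-- The Fourier transform in the variables `(z, y)` of a function of `((z, y), x)`. -/
def partialFourier (F : ((ι → ℝ) × (κ → ℝ)) × α → E) (l : ι → ℝ) (ξ : κ → ℝ) (x : α) : E :=
  ∫ w : (ι → ℝ) × (κ → ℝ), 𝐞 (l ⬝ᵥ w.1 + ξ ⬝ᵥ w.2) • F (w, x)

theorem enorm_partialFourier_le (F : ((ι → ℝ) × (κ → ℝ)) × α → E) (l : ι → ℝ) (ξ : κ → ℝ)
    (x : α) : ‖partialFourier F l ξ x‖ₑ ≤ ∫⁻ w, ‖F (w, x)‖ₑ := by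
  refine (enorm_integral_le_lintegral_enorm _).trans_eq (lintegral_congr fun w => ?_)
  rw [← ofReal_norm, Circle.norm_smul, ofReal_norm]

theorem stronglyMeasurable_partialFourier [MeasurableSpace α]
    {F : ((ι → ℝ) × (κ → ℝ)) × α → E} (hF : StronglyMeasurable F) :
    StronglyMeasurable fun q : ((ι → ℝ) × (κ → ℝ)) × α => partialFourier F q.1.1 q.1.2 q.2 := by
  have h : StronglyMeasurable fun q : (((ι → ℝ) × (κ → ℝ)) × α) × ((ι → ℝ) × (κ → ℝ)) =>
      𝐞 (q.1.1.1 ⬝ᵥ q.2.1 + q.1.1.2 ⬝ᵥ q.2.2) • F (q.2, q.1.2) := by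
    have hphase : Measurable fun q : (((ι → ℝ) × (κ → ℝ)) × α) × ((ι → ℝ) × (κ → ℝ)) =>
        q.1.1.1 ⬝ᵥ q.2.1 + q.1.1.2 ⬝ᵥ q.2.2 := by
      unfold dotProduct
      fun_prop
    exact (Real.continuous_fourierChar.comp_stronglyMeasurable hphase.stronglyMeasurable).smul
      (hF.comp_measurable (measurable_snd.prodMk measurable_fst.snd))
  exact h.integral_prod_right'

theorem lintegral_enorm_sq_partialFourier {H : Type*} [NormedAddCommGroup H]
    [InnerProductSpace ℂ H] [CompleteSpace H] [MeasureSpace α] [SFinite (volume : Measure α)]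
    {F : ((ι → ℝ) × (κ → ℝ)) × α → H} (hFm : StronglyMeasurable F) (hF : Integrable F)
    (hF2 : MemLp F 2) :
    ∫⁻ x, ∫⁻ q : (ι → ℝ) × (κ → ℝ), ‖partialFourier F q.1 q.2 x‖ₑ ^ 2 = ∫⁻ v, ‖F v‖ₑ ^ 2 := by
  have hm : Measurable fun v => ‖F v‖ₑ ^ 2 := hFm.enorm.pow_const 2
  have hfubini : ∫⁻ v, ‖F v‖ₑ ^ 2 = ∫⁻ x, ∫⁻ w, ‖F (w, x)‖ₑ ^ 2 := lintegral_prod_symm' _ hm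
  have hfin : ∀ᵐ x, ∫⁻ w, ‖F (w, x)‖ₑ ^ 2 < ∞ := by
    refine ae_lt_top hm.lintegral_prod_left' ?_
    rw [← hfubini]
    exact (memLp_two_iff_lintegral_enorm_sq_ne_top hF2.1).1 hF2
  rw [hfubini]
  refine lintegral_congr_ae ?_
  filter_upwards [hF.prod_left_ae, hfin] with x hint hx
  have hmeas : AEStronglyMeasurable fun w => F (w, x) :=
    (hFm.comp_measurable measurable_prodMk_right).aestronglyMeasurable
  exact lintegral_enorm_sq_integral_fourierChar_prod hint
    ((memLp_two_iff_lintegral_enorm_sq_ne_top hmeas).2 hx.ne)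

theorem integral_fourierChar_smul_indicator_sub {χ : Type*} [Fintype χ]
    {F : ((ι → ℝ) × (κ → ℝ)) × (χ → ℝ) → E} (hF : Integrable F) {S : Set (χ → ℝ)}
    (hS : MeasurableSet S) (l : ι → ℝ) (ξ : κ → ℝ) (t : χ → ℝ) :
    ∫ v, 𝐞 (l ⬝ᵥ v.1.1 + ξ ⬝ᵥ v.1.2) • S.indicator (fun _ => F v) (t - v.2) =
      ∫ s in S, partialFourier F l ξ (t - s) := by
  have hint : Integrable fun v : ((ι → ℝ) × (κ → ℝ)) × (χ → ℝ) =>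
      𝐞 (l ⬝ᵥ v.1.1 + ξ ⬝ᵥ v.1.2) • S.indicator (fun _ => F v) (t - v.2) := by
    have hphase : Continuous fun v : ((ι → ℝ) × (κ → ℝ)) × (χ → ℝ) =>
        l ⬝ᵥ v.1.1 + ξ ⬝ᵥ v.1.2 := by fun_prop
    exact integrable_fourierChar_smul hphase.measurable
      (hF.indicator (measurable_snd.const_sub t hS))
  rw [Measure.volume_eq_prod, integral_prod_symm _ hint, ← integral_sub_left_eq_self _ volume t,
    ← integral_indicator hS]
  refine integral_congr_ae (Filter.Eventually.of_forall fun s => ?_)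
  simp only [sub_sub_cancel]
  by_cases hs : s ∈ S
  · simp only [Set.indicator_of_mem hs, partialFourier]
  · simp only [Set.indicator_of_notMem hs, smul_zero, integral_zero]

end PartialFourier

namespace ExpGroup

variable {p d : ℕ} {𝔫 : Type*} [LieRing 𝔫] [LieAlgebra ℝ 𝔫] (D : NilpotentAlgebra p d 𝔫)

/-- The parametrization of `N` by the coordinates `((z, y), x)`. -/
def prodCoords : ((Fin p → ℝ) × (Fin d → ℝ)) × (Fin d → ℝ) ≃ᵐ ExpGroup D :=
  MeasurableEquiv.prodAssoc.trans (coordsMeas D).symm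

theorem measurePreserving_prodCoords : MeasurePreserving (prodCoords D) volume (haar D) :=
  ((measurePreserving_coords D).symm (coordsMeas D)).comp volume_preserving_prodAssoc

theorem coords_prodCoords (v : ((Fin p → ℝ) × (Fin d → ℝ)) × (Fin d → ℝ)) :
    coords D (prodCoords D v) = (v.1.1, v.1.2, v.2) :=
  (coords D).apply_symm_apply _

/-- The kernel `(t, s) ↦ ∫ e^{2πi(⟨λ, z⟩ + ⟨t, B(λ) y⟩)} f(z, y, t - s) dz dy` of the operator
`∫ f(n) π_λ(n) dn`. -/
def fourierKernel (f : ExpGroup D → ℂ) (l : Fin p → ℝ) (s : (Fin d → ℝ) × (Fin d → ℝ)) : ℂ :=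
  partialFourier (fun v => f (prodCoords D v)) l ((D.B l)ᵀ *ᵥ s.1) (s.1 - s.2)

variable {D} {f : ExpGroup D → ℂ}

theorem stronglyMeasurable_comp_prodCoords (hf : Measurable f) :
    StronglyMeasurable fun v => f (prodCoords D v) :=
  (hf.comp (prodCoords D).measurable).stronglyMeasurable

theorem measurable_fourierKernel (hf : Measurable f) (l : Fin p → ℝ) :
    Measurable (fourierKernel D f l) := by
  have hc : Continuous fun s : (Fin d → ℝ) × (Fin d → ℝ) =>
      ((l, (D.B l)ᵀ *ᵥ s.1), s.1 - s.2) := by fun_prop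
  have h := (stronglyMeasurable_partialFourier
    (stronglyMeasurable_comp_prodCoords (D := D) hf)).measurable.comp hc.measurable
  exact h

theorem integrableOn_fourierKernel (hfm : Measurable f) (hf : Integrable f (haar D))
    (l : Fin p → ℝ) {T : Set (Fin d → ℝ)} (hT : volume T < ∞) (S : Set (Fin d → ℝ)) :
    IntegrableOn (fourierKernel D f l) (T ×ˢ S) := by
  let F := fun v => f (prodCoords D v)
  have hFm : StronglyMeasurable F := stronglyMeasurable_comp_prodCoords hfm
  have hF : Integrable F := (measurePreserving_prodCoords D).integrable_comp_of_integrable hf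
  have hm := measurable_fourierKernel hfm l
  refine ⟨hm.aestronglyMeasurable, ?_⟩
  rw [HasFiniteIntegral, Measure.volume_eq_prod, ← Measure.prod_restrict,
    lintegral_prod _ hm.enorm.aemeasurable]
  calc ∫⁻ t in T, ∫⁻ s in S, ‖fourierKernel D f l (t, s)‖ₑ
      ≤ ∫⁻ t in T, ∫⁻ s, ∫⁻ w, ‖F (w, t - s)‖ₑ := lintegral_mono fun t =>
        (setLIntegral_le_lintegral _ _).trans (lintegral_mono fun s => enorm_partialFourier_le ..)
    _ = ∫⁻ _ in T, ∫⁻ v, ‖F v‖ₑ := lintegral_congr fun t =>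
        (lintegral_sub_left_eq_self (fun x => ∫⁻ w, ‖F (w, x)‖ₑ) t).trans
          (lintegral_prod_symm' _ hFm.enorm).symm
    _ < ∞ := by
        rw [lintegral_const, Measure.restrict_apply_univ]
        exact ENNReal.mul_lt_top hF.2 hT

theorem inner_indicatorConstLp_rep {T S : Set (Fin d → ℝ)} (hT : MeasurableSet T)
    (hS : MeasurableSet S) (hTv : volume T ≠ ∞) (hSv : volume S ≠ ∞) (l : Fin p → ℝ)
    (n : ExpGroup D) :
    inner ℂ (indicatorConstLp 2 hT hTv (1 : ℂ)) (rep D l n (indicatorConstLp 2 hS hSv (1 : ℂ))) =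
      ∫ t in T, (𝐞 (phase D n l t) : ℂ) * S.indicator 1 (t - (coords D n).2.2) := by
  rw [L2.inner_indicatorConstLp_one]
  refine integral_congr_ae (ae_restrict_of_ae ?_)
  filter_upwards [coeFn_rep D l n (indicatorConstLp 2 hS hSv (1 : ℂ)),
    (measurePreserving_sub_right volume (coords D n).2.2).quasiMeasurePreserving.ae
      (indicatorConstLp_coeFn (p := 2) (hs := hS) (hμs := hSv) (c := (1 : ℂ)))] with t h1 h2
  rw [h1, h2]
  rfl

theorem tensor_indicatorConstLp {T S : Set (Fin d → ℝ)} (hT : MeasurableSet T)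
    (hS : MeasurableSet S) (hTv : volume T ≠ ∞) (hSv : volume S ≠ ∞)
    (hTS : volume (T ×ˢ S) ≠ ∞) :
    tensor (indicatorConstLp 2 hT hTv (1 : ℂ)) (indicatorConstLp 2 hS hSv (1 : ℂ)) =
      indicatorConstLp 2 (hT.prod hS) hTS (1 : ℂ) := by
  refine Lp.ext ?_
  filter_upwards [coeFn_tensor (indicatorConstLp 2 hT hTv (1 : ℂ))
      (indicatorConstLp 2 hS hSv (1 : ℂ)),
    indicatorConstLp_coeFn (p := 2) (hs := hT.prod hS) (c := (1 : ℂ)) (hμs := hTS),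
    Measure.quasiMeasurePreserving_fst.ae
      (indicatorConstLp_coeFn (p := 2) (hs := hT) (hμs := hTv) (c := (1 : ℂ))),
    Measure.quasiMeasurePreserving_snd.ae
      (indicatorConstLp_coeFn (p := 2) (hs := hS) (hμs := hSv) (c := (1 : ℂ)))] with s h1 h2 h3 h4
  rw [h1, h2, h3, h4]
  by_cases ht : s.1 ∈ T <;> by_cases hs : s.2 ∈ S <;> simp [ht, hs, Set.mem_prod]

theorem integral_mul_inner_rep_indicator (hfm : Measurable f) (hf : Integrable f (haar D))
    {T S : Set (Fin d → ℝ)} (hT : MeasurableSet T) (hS : MeasurableSet S) (hTv : volume T ≠ ∞)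
    (hSv : volume S ≠ ∞) (l : Fin p → ℝ) :
    ∫ n, f n * inner ℂ (indicatorConstLp 2 hT hTv (1 : ℂ))
        (rep D l n (indicatorConstLp 2 hS hSv (1 : ℂ))) ∂haar D =
      ∫ s in T ×ˢ S, fourierKernel D f l s := by
  let F := fun v => f (prodCoords D v)
  let ξ := fun t => (D.B l)ᵀ *ᵥ t
  have hp := measurePreserving_prodCoords D
  have hF : Integrable F := hp.integrable_comp_of_integrable hf
  have hint : Integrable (Function.uncurry fun v t =>
      𝐞 (l ⬝ᵥ v.1.1 + ξ t ⬝ᵥ v.1.2) • S.indicator (fun _ => F v) (t - v.2))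
      (volume.prod (volume.restrict T)) := by
    have : IsFiniteMeasure (volume.restrict T) := ⟨by simpa using hTv.lt_top⟩
    have hphase : Continuous fun x : (((Fin p → ℝ) × (Fin d → ℝ)) × (Fin d → ℝ)) × (Fin d → ℝ) =>
        l ⬝ᵥ x.1.1.1 + ξ x.2 ⬝ᵥ x.1.1.2 := by fun_prop
    exact integrable_fourierChar_smul hphase.measurable ((hF.comp_fst _).indicator
      ((measurable_snd.sub measurable_fst.snd) hS))
  calc ∫ n, f n * inner ℂ (indicatorConstLp 2 hT hTv (1 : ℂ))
        (rep D l n (indicatorConstLp 2 hS hSv (1 : ℂ))) ∂haar D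
      = ∫ v, ∫ t in T, 𝐞 (l ⬝ᵥ v.1.1 + ξ t ⬝ᵥ v.1.2) • S.indicator (fun _ => F v) (t - v.2) := by
        rw [← hp.integral_comp']
        refine integral_congr_ae (Filter.Eventually.of_forall fun v => ?_)
        simp only [inner_indicatorConstLp_rep, ← integral_const_mul, phase, coords_prodCoords, ξ,
          Matrix.mulVec_transpose, Matrix.dotProduct_mulVec]
        refine integral_congr_ae (Filter.Eventually.of_forall fun t => ?_)
        by_cases hs : t - v.2 ∈ S <;> simp [hs, F, Circle.smul_def, mul_comm]
    _ = ∫ t in T, ∫ s in S, partialFourier F l (ξ t) (t - s) := by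
        rw [integral_integral_swap hint]
        simp only [integral_fourierChar_smul_indicator_sub hF hS]
    _ = ∫ s in T ×ˢ S, fourierKernel D f l s := by
        rw [Measure.volume_eq_prod, setIntegral_prod]
        · rfl
        · exact integrableOn_fourierKernel hfm hf l hTv.lt_top S

theorem IsFourierAt.ae_eq_fourierKernel (hfm : Measurable f) (hf : Integrable f (haar D))
    {l : Fin p → ℝ} {k : HS d} (h : IsFourierAt D f l k) :
    k =ᵐ[volume] fourierKernel D f l := by
  refine ae_eq_of_forall_setIntegral_prod_eq (fun T S hT hS => ?_)
    (fun T S hT _ => integrableOn_fourierKernel hfm hf l hT S) fun T S hT hS hTv hSv => ?_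
  · have : IsFiniteMeasure ((volume : Measure ((Fin d → ℝ) × (Fin d → ℝ))).restrict (T ×ˢ S)) :=
      ⟨by simpa [Measure.volume_eq_prod] using ENNReal.mul_lt_top hT hS⟩
    exact ((Lp.memLp k).restrict (T ×ˢ S)).integrable (by norm_num)
  · have hTS : volume (T ×ˢ S) ≠ ∞ := by
      rw [Measure.volume_eq_prod, Measure.prod_prod]
      exact (ENNReal.mul_lt_top hTv hSv).ne
    have hTS' := h (indicatorConstLp 2 hS hSv.ne (1 : ℂ)) (indicatorConstLp 2 hT hTv.ne (1 : ℂ))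
    rw [integral_mul_inner_rep_indicator hfm hf, tensor_indicatorConstLp hT hS hTv.ne hSv.ne hTS,
      L2.inner_indicatorConstLp_one] at hTS'
    exact hTS'

end ExpGroup

/-! ### The Plancherel transform -/

variable {p d : ℕ} {𝔫 : Type*} [LieRing 𝔫] [LieAlgebra ℝ 𝔫] (D : NilpotentAlgebra p d 𝔫)

namespace NilpotentAlgebra

theorem measurable_ofReal_abs_det_B : Measurable fun l => ENNReal.ofReal |(D.B l).det| :=
  (ENNReal.continuous_ofReal.comp D.continuous_det_B.abs).measurable

theorem plancherelMeasure_eq :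
    D.plancherelMeasure = volume.withDensity fun l => ENNReal.ofReal |(D.B l).det| := by
  rw [plancherelMeasure, Measure.restrict_eq_self_of_ae_mem D.ae_mem_crossSection]

theorem ae_plancherelMeasure_iff {P : (Fin p → ℝ) → Prop} :
    (∀ᵐ l ∂D.plancherelMeasure, P l) ↔ ∀ᵐ l, P l := by
  rw [plancherelMeasure_eq, ae_withDensity_iff D.measurable_ofReal_abs_det_B]
  refine ⟨fun h => ?_, fun h => h.mono fun l hl _ => hl⟩
  filter_upwards [h, D.ae_mem_crossSection] with l hl hlD
  exact hl (ENNReal.ofReal_pos.2 (abs_pos.2 hlD)).ne'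

theorem lintegral_plancherelMeasure (h : (Fin p → ℝ) → ℝ≥0∞) :
    ∫⁻ l, h l ∂D.plancherelMeasure = ∫⁻ l, ENNReal.ofReal |(D.B l).det| * h l := by
  rw [plancherelMeasure_eq, lintegral_withDensity_eq_lintegral_mul_non_measurable _
    D.measurable_ofReal_abs_det_B (Filter.Eventually.of_forall fun _ => ENNReal.ofReal_lt_top)]
  rfl

theorem integral_plancherelMeasure (h : (Fin p → ℝ) → ℂ) :
    ∫ l, h l ∂D.plancherelMeasure = ∫ l, ((|(D.B l).det| : ℝ) : ℂ) * h l := by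
  rw [plancherelMeasure_eq, integral_withDensity_eq_integral_toReal_smul
    D.measurable_ofReal_abs_det_B (by simp)]
  simp

end NilpotentAlgebra

theorem lintegral_enorm_sq_partialFourier_mulVec {ι κ E : Type*} [Fintype ι] [Fintype κ]
    [DecidableEq κ] [NormedAddCommGroup E] [NormedSpace ℂ E]
    {F : ((ι → ℝ) × (κ → ℝ)) × (κ → ℝ) → E} (hF : StronglyMeasurable F) (l : ι → ℝ)
    {M : Matrix κ κ ℝ} (hM : M.det ≠ 0) :
    ∫⁻ s : (κ → ℝ) × (κ → ℝ), ‖partialFourier F l (M *ᵥ s.1) (s.1 - s.2)‖ₑ ^ 2 =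
      ENNReal.ofReal |M.det|⁻¹ * ∫⁻ y, ∫⁻ ξ, ‖partialFourier F l ξ y‖ₑ ^ 2 := by
  let Q := fun (ξ y : κ → ℝ) => ‖partialFourier F l ξ y‖ₑ ^ 2
  have hQ : Measurable (Function.uncurry Q) := by
    have hc : Measurable fun q : (κ → ℝ) × (κ → ℝ) => ((l, q.1), q.2) := by fun_prop
    exact ((stronglyMeasurable_partialFourier hF).comp_measurable hc).enorm.pow_const 2
  have hshift : Continuous fun s : (κ → ℝ) × (κ → ℝ) => (M *ᵥ s.1, s.1 - s.2) := by fun_prop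
  have hmul : Continuous fun s : (κ → ℝ) × (κ → ℝ) => (M *ᵥ s.1, s.2) := by fun_prop
  calc ∫⁻ s : (κ → ℝ) × (κ → ℝ), Q (M *ᵥ s.1) (s.1 - s.2)
      = ∫⁻ t, ∫⁻ s, Q (M *ᵥ t) (t - s) :=
        lintegral_prod _ (hQ.comp hshift.measurable).aemeasurable
    _ = ∫⁻ t, ∫⁻ y, Q (M *ᵥ t) y :=
        lintegral_congr fun t => lintegral_sub_left_eq_self (Q (M *ᵥ t)) t
    _ = ∫⁻ y, ∫⁻ t, Q (M *ᵥ t) y :=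
        lintegral_lintegral_swap (hQ.comp hmul.measurable).aemeasurable
    _ = ∫⁻ y, ENNReal.ofReal |M.det|⁻¹ * ∫⁻ ξ, Q ξ y :=
        lintegral_congr fun y => lintegral_comp_mulVec hM fun ξ => Q ξ y
    _ = ENNReal.ofReal |M.det|⁻¹ * ∫⁻ y, ∫⁻ ξ, Q ξ y :=
        lintegral_const_mul _ hQ.lintegral_prod_left'

namespace ExpGroup

variable {D}

theorem IsFourierAt.enorm_sq {f : ExpGroup D → ℂ} (hfm : Measurable f)
    (hf : Integrable f (haar D)) {l : Fin p → ℝ} (hl : l ∈ D.crossSection) {k : HS d}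
    (h : IsFourierAt D f l k) :
    ENNReal.ofReal |(D.B l).det| * ‖k‖ₑ ^ 2 =
      ∫⁻ y, ∫⁻ ξ, ‖partialFourier (fun v => f (prodCoords D v)) l ξ y‖ₑ ^ 2 := by
  have hdet : 0 < |(D.B l).det| := abs_pos.2 hl
  have hk : ‖k‖ₑ ^ 2 = ∫⁻ s, ‖fourierKernel D f l s‖ₑ ^ 2 := by
    rw [← lintegral_enorm_sq_coeFn]
    refine lintegral_congr_ae ?_
    filter_upwards [h.ae_eq_fourierKernel hfm hf] with s hs
    rw [hs]
  unfold fourierKernel at hk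
  rw [hk, lintegral_enorm_sq_partialFourier_mulVec (stronglyMeasurable_comp_prodCoords hfm) l
      (by rwa [Matrix.det_transpose]), Matrix.det_transpose, ← mul_assoc,
    ← ENNReal.ofReal_mul hdet.le, mul_inv_cancel₀ hdet.ne', ENNReal.ofReal_one, one_mul]

theorem lintegral_enorm_sq_partialFourier_comp_prodCoords {f : ExpGroup D → ℂ}
    (hfm : Measurable f) (hf : Integrable f (haar D)) (hf2 : MemLp f 2 (haar D)) :
    ∫⁻ l, ∫⁻ y, ∫⁻ ξ, ‖partialFourier (fun v => f (prodCoords D v)) l ξ y‖ₑ ^ 2 =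
      ∫⁻ n, ‖f n‖ₑ ^ 2 ∂haar D := by
  let F := fun v => f (prodCoords D v)
  have hp := measurePreserving_prodCoords D
  have hFm : StronglyMeasurable F := stronglyMeasurable_comp_prodCoords hfm
  have hm := (stronglyMeasurable_partialFourier hFm).enorm.pow_const 2
  have hswap : Measurable fun q : ((Fin p → ℝ) × (Fin d → ℝ)) × (Fin d → ℝ) =>
      ((q.1.1, q.2), q.1.2) := by fun_prop
  calc ∫⁻ l, ∫⁻ y, ∫⁻ ξ, ‖partialFourier F l ξ y‖ₑ ^ 2
      = ∫⁻ y, ∫⁻ l, ∫⁻ ξ, ‖partialFourier F l ξ y‖ₑ ^ 2 :=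
        lintegral_lintegral_swap (hm.comp hswap).lintegral_prod_right'.aemeasurable
    _ = ∫⁻ y, ∫⁻ q : (Fin p → ℝ) × (Fin d → ℝ), ‖partialFourier F q.1 q.2 y‖ₑ ^ 2 :=
        lintegral_congr fun y =>
          (lintegral_prod _ (hm.comp measurable_prodMk_right).aemeasurable).symm
    _ = ∫⁻ v, ‖F v‖ₑ ^ 2 := lintegral_enorm_sq_partialFourier hFm
        (hp.integrable_comp_of_integrable hf) (hf2.comp_measurePreserving hp)
    _ = ∫⁻ n, ‖f n‖ₑ ^ 2 ∂haar D :=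
        hp.lintegral_comp_emb (prodCoords D).measurableEmbedding fun n => ‖f n‖ₑ ^ 2

theorem enorm_sq_eq_of_mem_fourierGraph {x : L2N D × DirectIntegral D}
    (hx : x ∈ fourierGraph D) : ‖x.2‖ₑ ^ 2 = ‖x.1‖ₑ ^ 2 := by
  have hfm : Measurable x.1 := (Lp.stronglyMeasurable x.1).measurable
  rw [← lintegral_enorm_sq_coeFn, D.lintegral_plancherelMeasure, ← lintegral_enorm_sq_coeFn,
    ← lintegral_enorm_sq_partialFourier_comp_prodCoords hfm hx.1 (Lp.memLp x.1)]
  refine lintegral_congr_ae ?_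
  filter_upwards [D.ae_plancherelMeasure_iff.1 hx.2, D.ae_mem_crossSection] with l h hl
  exact h.enorm_sq hfm hx.1 hl

theorem aestronglyMeasurable_inner_rep (l : Fin p → ℝ) (h h' : L2R d) :
    AEStronglyMeasurable (fun n => inner ℂ h' (rep D l n h)) (haar D) := by
  have hx : Measurable fun q : ExpGroup D × (Fin d → ℝ) => q.2 - (coords D q.1).2.2 :=
    measurable_snd.sub ((coordsHomeo D).continuous.measurable.comp measurable_fst).snd.snd
  have hphase : Measurable fun q : ExpGroup D × (Fin d → ℝ) => phase D q.1 l q.2 := by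
    have hc : Measurable fun q : ExpGroup D × (Fin d → ℝ) => (coords D q.1, q.2) :=
      ((coordsHomeo D).continuous.measurable.comp measurable_fst).prodMk measurable_snd
    have hdot : Continuous fun c : ((Fin p → ℝ) × (Fin d → ℝ) × (Fin d → ℝ)) × (Fin d → ℝ) =>
        l ⬝ᵥ c.1.1 + c.2 ⬝ᵥ (D.B l *ᵥ c.1.2.1) := by fun_prop
    exact hdot.measurable.comp hc
  have hm : StronglyMeasurable fun q : ExpGroup D × (Fin d → ℝ) =>
      inner ℂ (h' q.2) ((𝐞 (phase D q.1 l q.2) : ℂ) * h (q.2 - (coords D q.1).2.2)) :=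
    ((Lp.stronglyMeasurable h').comp_measurable measurable_snd).inner
      ((continuous_subtype_val.comp Real.continuous_fourierChar).comp_stronglyMeasurable
        hphase.stronglyMeasurable |>.mul ((Lp.stronglyMeasurable h).comp_measurable hx))
  refine (hm.integral_prod_right' (ν := volume)).aestronglyMeasurable.congr (.of_forall fun n => ?_)
  beta_reduce
  rw [L2.inner_def]
  refine integral_congr_ae ?_
  filter_upwards [coeFn_rep D l n h] with t ht
  rw [ht]

theorem integrable_mul_inner_rep {f : ExpGroup D → ℂ} (hf : Integrable f (haar D))
    (l : Fin p → ℝ) (h h' : L2R d) :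
    Integrable (fun n => f n * inner ℂ h' (rep D l n h)) (haar D) := by
  refine hf.mul_bdd (c := ‖h'‖ * ‖h‖) (aestronglyMeasurable_inner_rep l h h')
    (.of_forall fun n => ?_)
  simpa only [norm_rep] using norm_inner_le_norm (𝕜 := ℂ) h' (rep D l n h)

theorem IsFourierAt.congr {f f' : ExpGroup D → ℂ} {l : Fin p → ℝ} {k : HS d}
    (h : IsFourierAt D f l k) (hf : f =ᵐ[haar D] f') : IsFourierAt D f' l k := fun v w => by
  rw [h v w]
  refine integral_congr_ae ?_
  filter_upwards [hf] with n hn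
  rw [hn]

theorem isFourierAt_zero (l : Fin p → ℝ) : IsFourierAt D 0 l 0 := fun v w => by simp

theorem IsFourierAt.add {f f' : ExpGroup D → ℂ} {l : Fin p → ℝ} {k k' : HS d}
    (h : IsFourierAt D f l k) (h' : IsFourierAt D f' l k') (hf : Integrable f (haar D))
    (hf' : Integrable f' (haar D)) : IsFourierAt D (f + f') l (k + k') := fun v w => by
  simp only [inner_add_right, h v w, h' v w, Pi.add_apply, add_mul]
  exact (integral_add (integrable_mul_inner_rep hf l v w)
    (integrable_mul_inner_rep hf' l v w)).symm

theorem IsFourierAt.const_smul {f : ExpGroup D → ℂ} {l : Fin p → ℝ} {k : HS d}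
    (h : IsFourierAt D f l k) (c : ℂ) : IsFourierAt D (c • f) l (c • k) := fun v w => by
  simp only [inner_smul_right, h v w, Pi.smul_apply, smul_eq_mul, mul_assoc, integral_const_mul]

variable (D)

/-- The graph of the Fourier transform on `L¹(N) ∩ L²(N)`, as a subspace. -/
def fourierGraphSubmodule : Submodule ℂ (L2N D × DirectIntegral D) where
  carrier := fourierGraph D
  zero_mem' := by
    have h0 := Lp.coeFn_zero ℂ 2 (haar D)
    refine ⟨(integrable_zero _ ℂ (haar D)).congr h0.symm, ?_⟩
    filter_upwards [Lp.coeFn_zero (HS d) 2 D.plancherelMeasure] with l hl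
    exact hl ▸ (isFourierAt_zero l).congr h0.symm
  add_mem' {x y} hx hy := by
    have hxy := Lp.coeFn_add x.1 y.1
    refine ⟨(hx.1.add hy.1).congr hxy.symm, ?_⟩
    filter_upwards [hx.2, hy.2, Lp.coeFn_add x.2 y.2] with l hxl hyl hl
    exact hl ▸ (hxl.add hyl hx.1 hy.1).congr hxy.symm
  smul_mem' c x hx := by
    have hcx := Lp.coeFn_smul c x.1
    refine ⟨(hx.1.smul c).congr hcx.symm, ?_⟩
    filter_upwards [hx.2, Lp.coeFn_smul c x.2] with l hxl hl
    exact hl ▸ (hxl.const_smul c).congr hcx.symm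

variable {D}

theorem norm_eq_of_mem_plancherelGraph {x : L2N D × DirectIntegral D}
    (hx : x ∈ plancherelGraph D) : ‖x.2‖ = ‖x.1‖ := by
  have hspan : Submodule.span ℂ (fourierGraph D) ≤ fourierGraphSubmodule D :=
    Submodule.span_le.2 subset_rfl
  refine closure_minimal (fun y hy => ?_)
    (isClosed_eq continuous_snd.norm continuous_fst.norm) hx
  have h := enorm_sq_eq_of_mem_fourierGraph (hspan hy)
  exact enorm_eq_iff_norm_eq.1 ((ENNReal.pow_right_strictMono two_ne_zero).injective h)

theorem inner_eq_of_mem_plancherelGraph {x y : L2N D × DirectIntegral D}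
    (hx : x ∈ plancherelGraph D) (hy : y ∈ plancherelGraph D) :
    inner ℂ x.1 y.1 = inner ℂ x.2 y.2 := by
  have hIy := Submodule.smul_mem _ Complex.I hy
  have hadd := norm_eq_of_mem_plancherelGraph (Submodule.add_mem _ hx hy)
  have hsub := norm_eq_of_mem_plancherelGraph (Submodule.sub_mem _ hx hy)
  have haddI := norm_eq_of_mem_plancherelGraph (Submodule.add_mem _ hx hIy)
  have hsubI := norm_eq_of_mem_plancherelGraph (Submodule.sub_mem _ hx hIy)
  simp only [Prod.fst_add, Prod.snd_add, Prod.fst_sub, Prod.snd_sub, Prod.smul_fst,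
    Prod.smul_snd] at hadd hsub haddI hsubI
  rw [inner_eq_sum_norm_sq_div_four, inner_eq_sum_norm_sq_div_four]
  simp only [RCLike.I_to_complex, hadd, hsub, haddI, hsubI]

theorem IsPlancherelTransform.unique {φ : L2N D} {Φ Ψ : DirectIntegral D}
    (hΦ : IsPlancherelTransform D φ Φ) (hΨ : IsPlancherelTransform D φ Ψ) : Φ = Ψ := by
  have h := norm_eq_of_mem_plancherelGraph (Submodule.sub_mem _ hΦ hΨ)
  simpa [sub_eq_zero] using h

theorem isClosed_tensorRange {u : L2R d} (hu : ‖u‖ = 1) :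
    IsClosed (tensorRange u : Set (HS d)) := by
  let T : L2R d →ₗᵢ[ℂ] HS d :=
    { toFun := fun f => tensor f u
      map_add' := fun f g => tensor_add f g u
      map_smul' := fun c f => tensor_smul c f u
      norm_map' := fun f => by
        change ‖tensor f u‖ = _
        rw [norm_tensor, hu, mul_one] }
  exact T.isometry.isClosedEmbedding.isClosed_range

theorem isClosed_fieldSpace (I : Set (Fin p → ℝ)) {u : L2R d} (hu : ‖u‖ = 1) :
    IsClosed (fieldSpace D I u : Set (DirectIntegral D)) := by
  refine IsSeqClosed.isClosed fun Φ Ψ hΦ hlim => ?_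
  obtain ⟨ns, -, hns⟩ := (tendstoInMeasure_of_tendsto_Lp hlim).exists_seq_tendsto_ae
  change ∀ᵐ l ∂D.plancherelMeasure, _
  filter_upwards [hns, ae_all_iff.2 hΦ] with l hl hm
  refine ⟨fun hlI => ?_, fun hlI => ?_⟩
  · exact (isClosed_tensorRange hu).mem_of_tendsto hl (.of_forall fun n => (hm (ns n)).1 hlI)
  · refine tendsto_nhds_unique hl ?_
    simp only [(hm _).2 hlI]
    exact tendsto_const_nhds

theorem isClosed_bandSpace (I : Set (Fin p → ℝ)) {u : L2R d} (hu : ‖u‖ = 1) :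
    IsClosed (bandSpace D I u : Set (L2N D)) := by
  let W := plancherelGraph D ⊓ (fieldSpace D I u).comap (LinearMap.snd ℂ (L2N D) (DirectIntegral D))
  have hWc : IsClosed (W : Set (L2N D × DirectIntegral D)) :=
    (Submodule.isClosed_topologicalClosure _).inter
      ((isClosed_fieldSpace I hu).preimage continuous_snd)
  have : CompleteSpace W := hWc.completeSpace_coe
  let T : W →ₗᵢ[ℂ] L2N D :=
    { toLinearMap := (LinearMap.fst ℂ _ _).comp W.subtype
      norm_map' := fun x => by
        change ‖x.1.1‖ = max ‖x.1.1‖ ‖x.1.2‖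
        rw [norm_eq_of_mem_plancherelGraph x.2.1, max_self] }
  have hrange : (bandSpace D I u : Set (L2N D)) = Set.range T := by
    ext φ
    simp [bandSpace, T, W]
  rw [hrange]
  exact T.isometry.isClosedEmbedding.isClosed_range

end ExpGroup

/-! ### The quasi-lattice -/

theorem det_invDiag (v : Fin d → ℝ) : (invDiag v).det = (∏ i, v i)⁻¹ := by
  simp only [invDiag, Matrix.det_diagonal, one_div, Finset.prod_inv_distrib]

theorem det_invDiag_ne_zero {v : Fin d → ℝ} (hv : ∀ i, v i ≠ 0) : (invDiag v).det ≠ 0 := by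
  rw [det_invDiag]
  exact inv_ne_zero (Finset.prod_ne_zero_iff.2 fun i _ => hv i)

theorem invDiag_mulVec (v w : Fin d → ℝ) : invDiag v *ᵥ w = fun i => w i / v i := by
  ext i
  rw [invDiag, Matrix.mulVec_diagonal, one_div_mul_eq_div]

theorem ae_mem_latticeCell_invDiag {a : Fin p → ℝ} (ha : ∀ k, 0 < a k) (c : Fin p → ℝ) :
    ∀ᵐ l, l ∈ Set.Icc c (c + a) → l ∈ latticeCell (invDiag a) (invDiag a *ᵥ c) := by
  have hne : ∀ᵐ l : Fin p → ℝ, ∀ k, l k ≠ c k :=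
    ae_all_iff.2 fun k => Measure.ae_eval_ne (fun _ : Fin p => (volume : Measure ℝ)) k (c k)
  filter_upwards [hne] with l hl hlc k
  simp only [invDiag_mulVec]
  refine ⟨div_lt_div_of_pos_right (lt_of_le_of_ne (hlc.1 k) (hl k).symm) (ha k), ?_⟩
  rw [div_add_one (ha k).ne']
  exact div_le_div_of_nonneg_right (hlc.2 k) (ha k).le

namespace ExpGroup

variable {D} in
theorem prod_ofFn_exp {m : ℕ} (v : Fin m → 𝔫) (hv : ∀ i j, ⁅v i, v j⁆ = 0) :
    (List.ofFn fun j => (exp (v j) : ExpGroup D)).prod = exp (∑ j, v j) := by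
  induction m with
  | zero =>
    rw [List.ofFn_zero, List.prod_nil, Fin.sum_univ_zero]
    rfl
  | succ m ih =>
    rw [List.ofFn_succ, List.prod_cons, ih (fun j => v j.succ) fun i j => hv _ _, Fin.sum_univ_succ]
    ext
    simp [log_mul, lie_sum, hv]

theorem prod_exp_eq_mk3 (z : Fin p → ℝ) (y x : Fin d → ℝ) :
    (List.ofFn fun j => (exp (z j • D.Z j) : ExpGroup D)).prod *
      (List.ofFn fun j => (exp (y j • D.Y j) : ExpGroup D)).prod *
      (List.ofFn fun j => (exp (x j • D.X j) : ExpGroup D)).prod = mk3 D (z, y, x) := by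
  rw [prod_ofFn_exp, prod_ofFn_exp, prod_ofFn_exp]
  · rfl
  · intro i j
    simp [NilpotentAlgebra.X, D.lie_X_X]
  · intro i j
    simp [NilpotentAlgebra.Y, D.lie_Y_Y]
  · intro i j
    have hZ : D.Z i = D.sumZ (Pi.single i 1) := by
      simp [NilpotentAlgebra.sumZ, Pi.single_apply, ite_smul]
    rw [smul_lie, hZ, sumZ_lie, smul_zero]

/-- The point of the quasi-lattice `Γ_{a,q,b}` with integer coordinates `i = ((k, n), m)`, in the
order in which the orbit sums are taken: the Gabor indices `k`, `n` of the `Y` and `X` directions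
outside, the Fourier index `m` of the center inside. -/
def latticePoint (a : Fin p → ℝ) (q b : Fin d → ℝ)
    (i : ((Fin d → ℤ) × (Fin d → ℤ)) × (Fin p → ℤ)) : ExpGroup D :=
  mk3 D (fun j => i.2 j / a j, fun j => i.1.1 j / q j, fun j => i.1.2 j / b j)

theorem coords_latticePoint (a : Fin p → ℝ) (q b : Fin d → ℝ)
    (i : ((Fin d → ℤ) × (Fin d → ℤ)) × (Fin p → ℤ)) : coords D (latticePoint D a q b i) =
      (fun j => i.2 j / a j, fun j => i.1.1 j / q j, fun j => i.1.2 j / b j) :=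
  (coords D).apply_symm_apply _

theorem latticePoint_injective {a : Fin p → ℝ} {q b : Fin d → ℝ} (ha : ∀ k, a k ≠ 0)
    (hq : ∀ j, q j ≠ 0) (hb : ∀ j, b j ≠ 0) : Function.Injective (latticePoint D a q b) := by
  have hdiv {m : ℕ} {c : Fin m → ℝ} (hc : ∀ j, c j ≠ 0) (v w : Fin m → ℤ)
      (h : (fun j => (v j : ℝ) / c j) = fun j => (w j : ℝ) / c j) : v = w :=
    funext fun j => Int.cast_injective ((div_left_inj' (hc j)).1 (congrFun h j))
  intro i i' h
  have hcoords := congrArg (coords D) h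
  rw [coords_latticePoint, coords_latticePoint, Prod.mk.injEq, Prod.mk.injEq] at hcoords
  obtain ⟨hm, hk, hn⟩ := hcoords
  exact Prod.ext (Prod.ext (hdiv hq _ _ hk) (hdiv hb _ _ hn)) (hdiv ha _ _ hm)

/-- The parametrization of the quasi-lattice by integer vectors given by `latticePoint`. -/
def latticeEquiv {a : Fin p → ℝ} {q b : Fin d → ℝ} (ha : ∀ k, a k ≠ 0)
    (hq : ∀ j, q j ≠ 0) (hb : ∀ j, b j ≠ 0) :
    ((Fin d → ℤ) × (Fin d → ℤ)) × (Fin p → ℤ) ≃ quasiLattice D a q b :=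
  Equiv.ofBijective
    (fun i => ⟨latticePoint D a q b i, i.2, i.1.1, i.1.2, (prod_exp_eq_mk3 D _ _ _).symm⟩) (by
      refine ⟨fun i i' h => latticePoint_injective D ha hq hb (congrArg Subtype.val h), ?_⟩
      rintro ⟨γ, m, k, n, rfl⟩
      exact ⟨((k, n), m), Subtype.ext (prod_exp_eq_mk3 D _ _ _).symm⟩)

theorem phase_latticePoint (a : Fin p → ℝ) (q b : Fin d → ℝ) (i : (Fin d → ℤ) × (Fin d → ℤ))
    (m : Fin p → ℤ) (l : Fin p → ℝ) (t : Fin d → ℝ) :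
    phase D (latticePoint D a q b (i, m)) l t =
      (fun j => (m j : ℝ)) ⬝ᵥ (invDiag a *ᵥ l) + phase D (latticePoint D a q b (i, 0)) l t := by
  simp only [phase, coords_latticePoint, invDiag_mulVec, dotProduct, Pi.zero_apply, Int.cast_zero,
    zero_div, mul_zero, Finset.sum_const_zero, zero_add, mul_div_left_comm (l _)]

theorem repHS_latticePoint (a : Fin p → ℝ) (q b : Fin d → ℝ) (l : Fin p → ℝ)
    (i : (Fin d → ℤ) × (Fin d → ℤ)) (m : Fin p → ℤ) (T : HS d) :
    repHS D l (latticePoint D a q b (i, m)) T =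
      (𝐞 ((fun j => (m j : ℝ)) ⬝ᵥ (invDiag a *ᵥ l)) : ℂ) •
        repHS D l (latticePoint D a q b (i, 0)) T := by
  refine Lp.ext ?_
  filter_upwards [coeFn_repHS D l (latticePoint D a q b (i, m)) T,
    coeFn_repHS D l (latticePoint D a q b (i, 0)) T,
    Lp.coeFn_smul (𝐞 ((fun j => (m j : ℝ)) ⬝ᵥ (invDiag a *ᵥ l)) : ℂ)
      (repHS D l (latticePoint D a q b (i, 0)) T)] with s hm h0 hsmul
  rw [hm, hsmul, Pi.smul_apply, h0, smul_eq_mul, ← mul_assoc, phase_latticePoint,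
    AddChar.map_add_eq_mul, Circle.coe_mul, coords_latticePoint, coords_latticePoint]

theorem rep_latticePoint_zero (a : Fin p → ℝ) (q b : Fin d → ℝ) (l : Fin p → ℝ)
    (i : (Fin d → ℤ) × (Fin d → ℤ)) (g : L2R d) :
    rep D l (latticePoint D a q b (i, 0)) g =
      gaborSystem g (invDiag b) (D.B l * invDiag q) i := by
  rw [rep, coords_latticePoint, gaborSystem, ← Matrix.mulVec_mulVec, invDiag_mulVec, invDiag_mulVec]
  simp [dotProduct]

/-! ### Coefficients of the orbit of a vector -/

/-- The density with respect to `dλ` of `⟨V, (π_λ(n) E(λ))_λ⟩`. When `V` and `E` are the Plancherel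
transforms of `v` and `η`, its Fourier coefficients are the numbers `⟨v, L(γ)η⟩`. -/
def coeffFun (n : ExpGroup D) (V E : DirectIntegral D) (l : Fin p → ℝ) : ℂ :=
  ((|(D.B l).det| : ℝ) : ℂ) * inner ℂ (V l) (repHS D l n (E l))

theorem stronglyMeasurable_coeffFun (n : ExpGroup D) (V E : DirectIntegral D) :
    StronglyMeasurable (coeffFun D n V E) := by
  have hdet : StronglyMeasurable fun l => ((|(D.B l).det| : ℝ) : ℂ) :=
    (Complex.continuous_ofReal.comp D.continuous_det_B.abs).stronglyMeasurable
  have hrep : StronglyMeasurable fun l => repHS D l n (E l) :=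
    Continuous.comp_stronglyMeasurable
      (g := fun x : (Fin p → ℝ) × HS d => repHS D x.1 n x.2) (f := fun l => (l, E l))
      (continuous_uncurry_repHS D n) (stronglyMeasurable_id.prodMk (Lp.stronglyMeasurable E))
  exact hdet.mul ((Lp.stronglyMeasurable V).inner hrep)

theorem enorm_sq_coeffFun (n : ExpGroup D) (V E : DirectIntegral D) (l : Fin p → ℝ) :
    ‖coeffFun D n V E l‖ₑ ^ 2 = ENNReal.ofReal |(D.B l).det| *
      (ENNReal.ofReal |(D.B l).det| * ‖inner ℂ (V l) (repHS D l n (E l))‖ₑ ^ 2) := by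
  rw [coeffFun, enorm_mul, mul_pow, ← ofReal_norm, Complex.norm_real, Real.norm_eq_abs, abs_abs,
    sq, mul_assoc]

theorem inner_repField_latticePoint (a : Fin p → ℝ) (q b : Fin d → ℝ)
    (i : (Fin d → ℤ) × (Fin d → ℤ)) (m : Fin p → ℤ) (V E : DirectIntegral D) :
    inner ℂ V (repField D (latticePoint D a q b (i, m)) E) =
      ∫ l, (𝐞 ((fun j => (m j : ℝ)) ⬝ᵥ (invDiag a *ᵥ l)) : ℂ) *
        coeffFun D (latticePoint D a q b (i, 0)) V E l := by
  have hfibre : inner ℂ V (repField D (latticePoint D a q b (i, m)) E) =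
      ∫ l, inner ℂ (V l) (repHS D l (latticePoint D a q b (i, m)) (E l)) ∂D.plancherelMeasure := by
    rw [L2.inner_def]
    refine integral_congr_ae ?_
    filter_upwards [coeFn_repField D (latticePoint D a q b (i, m)) E] with l hl
    rw [hl]
  simp only [hfibre, D.integral_plancherelMeasure, repHS_latticePoint D a q b _ i m,
    inner_smul_right, coeffFun, mul_left_comm]

theorem tsum_enorm_sq_inner_repField_central {a : Fin p → ℝ} (ha : ∀ k, 0 < a k) (q b : Fin d → ℝ)
    {c : Fin p → ℝ} {V E : DirectIntegral D}
    (hV : ∀ᵐ l ∂D.plancherelMeasure, l ∉ Set.Icc c (c + a) → V l = 0)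
    (i : (Fin d → ℤ) × (Fin d → ℤ))
    (hL2 : MemLp (coeffFun D (latticePoint D a q b (i, 0)) V E) 2) :
    ∑' m : Fin p → ℤ, ‖inner ℂ V (repField D (latticePoint D a q b (i, m)) E)‖ₑ ^ 2 =
      ENNReal.ofReal (∏ k, a k) *
        ∫⁻ l, ‖coeffFun D (latticePoint D a q b (i, 0)) V E l‖ₑ ^ 2 := by
  have hdet : |(invDiag a).det|⁻¹ = ∏ k, a k := by
    rw [det_invDiag, abs_of_pos (inv_pos.2 (Finset.prod_pos fun k _ => ha k)), inv_inv]
  simp_rw [inner_repField_latticePoint]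
  rw [← hdet]
  refine tsum_enorm_sq_integral_of_latticeCell (det_invDiag_ne_zero fun k => (ha k).ne')
    (invDiag a *ᵥ c) hL2 ?_
  filter_upwards [D.ae_plancherelMeasure_iff.1 hV, ae_mem_latticeCell_invDiag ha c]
    with l hVl hcell hl
  simp only [coeffFun, hVl fun hbox => hl (hcell hbox), inner_zero_left, mul_zero]

theorem tsum_enorm_sq_inner_repField {a : Fin p → ℝ} (ha : ∀ k, 0 < a k) (q b : Fin d → ℝ)
    {c : Fin p → ℝ} {V E : DirectIntegral D}
    (hV : ∀ᵐ l ∂D.plancherelMeasure, l ∉ Set.Icc c (c + a) → V l = 0)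
    (hfibre : ∀ᵐ l ∂D.plancherelMeasure, ∑' i : (Fin d → ℤ) × (Fin d → ℤ),
      ENNReal.ofReal |(D.B l).det| *
        ‖inner ℂ (V l) (repHS D l (latticePoint D a q b (i, 0)) (E l))‖ₑ ^ 2 =
      (ENNReal.ofReal (∏ k, a k))⁻¹ * ‖V l‖ₑ ^ 2) :
    ∑' i, ‖inner ℂ V (repField D (latticePoint D a q b i) E)‖ₑ ^ 2 = ‖V‖ₑ ^ 2 := by
  let C := ENNReal.ofReal (∏ k, a k)
  have hC : C ≠ 0 := (ENNReal.ofReal_pos.2 (Finset.prod_pos fun k _ => ha k)).ne'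
  let φ i := coeffFun D (latticePoint D a q b (i, 0)) V E
  have hφ i : StronglyMeasurable (φ i) := stronglyMeasurable_coeffFun D _ V E
  have htotal : ∑' i, ∫⁻ l, ‖φ i l‖ₑ ^ 2 = C⁻¹ * ‖V‖ₑ ^ 2 := calc
    ∑' i, ∫⁻ l, ‖φ i l‖ₑ ^ 2 = ∫⁻ l, ∑' i, ‖φ i l‖ₑ ^ 2 :=
      (lintegral_tsum fun i => ((hφ i).enorm.pow_const 2).aemeasurable).symm
    _ = ∫⁻ l, C⁻¹ * ‖V l‖ₑ ^ 2 ∂D.plancherelMeasure := by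
      rw [D.lintegral_plancherelMeasure]
      refine lintegral_congr_ae ?_
      filter_upwards [D.ae_plancherelMeasure_iff.1 hfibre] with l hl
      simp only [φ, enorm_sq_coeffFun, ENNReal.tsum_mul_left (a := ENNReal.ofReal |(D.B l).det|)]
        at hl ⊢
      rw [hl]
    _ = C⁻¹ * ‖V‖ₑ ^ 2 := by
      rw [lintegral_const_mul _ ((Lp.stronglyMeasurable V).enorm.pow_const 2),
        lintegral_enorm_sq_coeFn]
  have hL2 i : MemLp (φ i) 2 := by
    rw [memLp_two_iff_lintegral_enorm_sq_ne_top (hφ i).aestronglyMeasurable]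
    refine ne_top_of_le_ne_top ?_ (ENNReal.le_tsum (f := fun i => ∫⁻ l, ‖φ i l‖ₑ ^ 2) i)
    rw [htotal]
    exact ENNReal.mul_ne_top (ENNReal.inv_ne_top.2 hC) (ENNReal.pow_ne_top enorm_ne_top)
  calc ∑' i, ‖inner ℂ V (repField D (latticePoint D a q b i) E)‖ₑ ^ 2
      = ∑' i, ∑' m, ‖inner ℂ V (repField D (latticePoint D a q b (i, m)) E)‖ₑ ^ 2 :=
        ENNReal.tsum_prod (f := fun i m =>
          ‖inner ℂ V (repField D (latticePoint D a q b (i, m)) E)‖ₑ ^ 2)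
    _ = ∑' i, C * ∫⁻ l, ‖φ i l‖ₑ ^ 2 :=
        tsum_congr fun i => tsum_enorm_sq_inner_repField_central D ha q b hV i (hL2 i)
    _ = ‖V‖ₑ ^ 2 := by
        rw [ENNReal.tsum_mul_left, htotal, ← mul_assoc,
          ENNReal.mul_inv_cancel hC ENNReal.ofReal_ne_top, one_mul]

end ExpGroup

/-! ### The orbit of the generator -/

theorem enorm_sq_inv_prod_sqrt_mul_sqrt {ι : Type*} [Fintype ι] {a : ι → ℝ} (ha : ∀ k, 0 ≤ a k)
    {x : ℝ} (hx : 0 ≤ x) :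
    ‖(((∏ k, √(a k)) * √x : ℝ) : ℂ)⁻¹‖ₑ ^ 2 = ENNReal.ofReal ((∏ k, a k)⁻¹ * x⁻¹) := by
  rw [← ofReal_norm, norm_inv, Complex.norm_real, ← ENNReal.ofReal_pow (by positivity), inv_pow,
    Real.norm_eq_abs, sq_abs, mul_pow, Real.sq_sqrt hx, ← Finset.prod_pow, mul_inv]
  simp only [Real.sq_sqrt (ha _)]

variable {D}

theorem enorm_tensor_of_norm_eq_one {u : L2R d} (hu : ‖u‖ = 1) (f : L2R d) :
    ‖tensor f u‖ₑ = ‖f‖ₑ := by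
  rw [enorm_eq_iff_norm_eq, norm_tensor, hu, mul_one]

namespace ExpGroup

theorem leftRegular_mem_bandSpace (γ : ExpGroup D) {I : Set (Fin p → ℝ)} {u : L2R d} {φ : L2N D}
    (hφ : φ ∈ bandSpace D I u) : leftRegular D γ φ ∈ bandSpace D I u := by
  obtain ⟨⟨φ, Φ⟩, ⟨hφΦ, hΦ⟩, rfl⟩ := hφ
  refine ⟨(leftRegular D γ φ, repField D γ Φ), ⟨isPlancherelTransform_leftRegular D hφΦ γ, ?_⟩, rfl⟩
  change ∀ᵐ l ∂D.plancherelMeasure, _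
  filter_upwards [hΦ, coeFn_repField D γ Φ] with l hl hrep
  simp only [LinearMap.snd_apply] at hl ⊢
  rw [hrep]
  refine ⟨fun hlI => ?_, fun hlI => by rw [hl.2 hlI, map_zero]⟩
  obtain ⟨f, hf⟩ := hl.1 hlI
  exact ⟨rep D l γ f, (repHS_tensor D l γ f u).symm.trans (congrArg (repHS D l γ) hf)⟩

theorem IsPlancherelTransform.enorm_eq {φ : L2N D} {Φ : DirectIntegral D}
    (h : IsPlancherelTransform D φ Φ) : ‖Φ‖ₑ = ‖φ‖ₑ := by
  have hnorm : ‖Φ‖ = ‖φ‖ := norm_eq_of_mem_plancherelGraph (x := (φ, Φ)) h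
  rw [← ofReal_norm, ← ofReal_norm, hnorm]

theorem IsPlancherelTransform.mem_fieldSpace {I : Set (Fin p → ℝ)} {u : L2R d} {φ : L2N D}
    {Φ : DirectIntegral D} (h : IsPlancherelTransform D φ Φ) (hφ : φ ∈ bandSpace D I u) :
    Φ ∈ fieldSpace D I u := by
  obtain ⟨⟨φ, Ψ⟩, ⟨hΨ, hmem⟩, rfl⟩ := hφ
  rwa [h.unique hΨ]

variable (D) in
/-- The value at `λ` of the Plancherel transform of the generator with windows `g(λ)`:
`(∏ √a_k)⁻¹ |det B(λ)|^{-1/2} g ⊗ u` for `g = g(λ)`. -/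
def generatorFibre (a : Fin p → ℝ) (l : Fin p → ℝ) (g u : L2R d) : HS d :=
  (((∏ k, √(a k)) * √|(D.B l).det| : ℝ) : ℂ)⁻¹ • tensor g u

section Fibre

variable {a : Fin p → ℝ} (ha : ∀ k, 0 < a k) {q b : Fin d → ℝ} {l : Fin p → ℝ}
  (hl : l ∈ D.crossSection) {u g : L2R d} (hu : ‖u‖ = 1)
  (hg : IsParsevalFrame (gaborSystem g (invDiag b) (D.B l * invDiag q)) ⊤)
include ha hl hu hg

theorem tsum_enorm_sq_inner_repHS_generatorFibre {T : HS d} (hT : T ∈ tensorRange u) :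
    ∑' i : (Fin d → ℤ) × (Fin d → ℤ), ENNReal.ofReal |(D.B l).det| *
        ‖inner ℂ T (repHS D l (latticePoint D a q b (i, 0)) (generatorFibre D a l g u))‖ₑ ^ 2 =
      (ENNReal.ofReal (∏ k, a k))⁻¹ * ‖T‖ₑ ^ 2 := by
  obtain ⟨f, rfl⟩ := hT
  have hdet : 0 < |(D.B l).det| := abs_pos.2 hl
  have hprod : 0 < ∏ k, a k := Finset.prod_pos fun k _ => ha k
  have huu : inner ℂ u u = 1 := by rw [inner_self_eq_norm_sq_to_K, hu]; simp
  have hparseval : ∑' i, ‖inner ℂ f (gaborSystem g (invDiag b) (D.B l * invDiag q) i)‖ₑ ^ 2 =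
      ‖f‖ₑ ^ 2 := by
    rw [(hasSum_norm_sq_iff (sq_nonneg _)).1 (hg.2 f Submodule.mem_top),
      ENNReal.ofReal_pow (norm_nonneg _), ofReal_norm]
  rw [enorm_tensor_of_norm_eq_one hu, ← hparseval, ← ENNReal.tsum_mul_left]
  refine tsum_congr fun i => ?_
  rw [generatorFibre, map_smul, repHS_tensor, rep_latticePoint_zero, inner_smul_right,
    inner_tensor_tensor, huu, mul_one, enorm_mul, mul_pow,
    enorm_sq_inv_prod_sqrt_mul_sqrt (fun k => (ha k).le) hdet.le, ← mul_assoc,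
    ← ENNReal.ofReal_mul hdet.le, mul_left_comm, mul_inv_cancel₀ hdet.ne', mul_one,
    ENNReal.ofReal_inv_of_pos hprod]

theorem enorm_sq_generatorFibre (hq : ∀ j, q j ≠ 0) (hb : ∀ j, b j ≠ 0) :
    ‖generatorFibre D a l g u‖ₑ ^ 2 =
      (ENNReal.ofReal ((∏ k, a k) / |(invDiag q).det * (invDiag b).det|))⁻¹ := by
  have hdet : 0 < |(D.B l).det| := abs_pos.2 hl
  have hprod : 0 < ∏ k, a k := Finset.prod_pos fun k _ => ha k
  have hQ := det_invDiag_ne_zero hq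
  have hA := det_invDiag_ne_zero hb
  have hdensity := enorm_sq_of_isParsevalFrame_gaborSystem hA
    (by rw [Matrix.det_mul]; exact mul_ne_zero hl hQ) hg
  rw [generatorFibre, enorm_smul, mul_pow, enorm_tensor_of_norm_eq_one hu, hdensity,
    enorm_sq_inv_prod_sqrt_mul_sqrt (fun k => (ha k).le) hdet.le,
    ← ENNReal.ofReal_mul (by positivity), ← ENNReal.ofReal_inv_of_pos (by positivity),
    Matrix.det_mul, abs_mul, abs_mul]
  congr 1
  field_simp

end Fibre

section Orbit

variable {a : Fin p → ℝ} (ha : ∀ k, 0 < a k) {q b : Fin d → ℝ} (hq : ∀ j, q j ≠ 0)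
  (hb : ∀ j, b j ≠ 0) {I : Set (Fin p → ℝ)} {u : L2R d} (hu : ‖u‖ = 1) {g : (Fin p → ℝ) → L2R d}
  (hg : ∀ᵐ l ∂D.plancherelMeasure, l ∈ I →
    IsParsevalFrame (gaborSystem (g l) (invDiag b) (D.B l * invDiag q)) ⊤)
  {η : L2N D} (hη : η ∈ bandSpace D I u) {E : DirectIntegral D} (hE : IsPlancherelTransform D η E)
  (hform : ∀ᵐ l ∂D.plancherelMeasure, l ∈ I → E l = generatorFibre D a l (g l) u)
include ha hu hg hform in
theorem ae_tsum_enorm_sq_inner_repHS {V : DirectIntegral D} (hV : V ∈ fieldSpace D I u) :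
    ∀ᵐ l ∂D.plancherelMeasure, ∑' i : (Fin d → ℤ) × (Fin d → ℤ), ENNReal.ofReal |(D.B l).det| *
        ‖inner ℂ (V l) (repHS D l (latticePoint D a q b (i, 0)) (E l))‖ₑ ^ 2 =
      (ENNReal.ofReal (∏ k, a k))⁻¹ * ‖V l‖ₑ ^ 2 := by
  filter_upwards [hV, hg, hform, D.ae_plancherelMeasure_iff.2 D.ae_mem_crossSection]
    with l hVl hgl hEl hl
  by_cases hlI : l ∈ I
  · rw [hEl hlI]
    exact tsum_enorm_sq_inner_repHS_generatorFibre ha hl hu (hgl hlI) (hVl.1 hlI)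
  · have hVl0 : V l = 0 := hVl.2 hlI
    simp [hVl0]

include ha hq hb hu hg hE hform in
theorem tsum_enorm_sq_inner_leftRegular {c : Fin p → ℝ} (hI : I ⊆ Set.Icc c (c + a)) {v : L2N D}
    {V : DirectIntegral D} (hvV : IsPlancherelTransform D v V) (hV : V ∈ fieldSpace D I u) :
    ∑' γ : quasiLattice D a q b, ‖inner ℂ v (leftRegular D (γ : ExpGroup D) η)‖ₑ ^ 2 =
      ‖v‖ₑ ^ 2 := by
  have hbox : ∀ᵐ l ∂D.plancherelMeasure, l ∉ Set.Icc c (c + a) → V l = 0 := by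
    filter_upwards [hV] with l hVl hl using hVl.2 fun hlI => hl (hI hlI)
  have hcoeff (γ : ExpGroup D) :
      inner ℂ v (leftRegular D γ η) = inner ℂ V (repField D γ E) :=
    inner_eq_of_mem_plancherelGraph hvV (isPlancherelTransform_leftRegular D hE γ)
  rw [← hvV.enorm_eq, ← tsum_enorm_sq_inner_repField D ha q b hbox
      (ae_tsum_enorm_sq_inner_repHS ha hu hg hform hV),
    ← (latticeEquiv D (fun k => (ha k).ne') hq hb).tsum_eq]
  exact tsum_congr fun i => congrArg (fun z : ℂ => ‖z‖ₑ ^ 2) (hcoeff _)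

include ha hq hb hu hg hη hE hform in
theorem isParsevalFrame_leftRegular {c : Fin p → ℝ} (hI : I ⊆ Set.Icc c (c + a)) :
    IsParsevalFrame (fun γ : quasiLattice D a q b => leftRegular D (γ : ExpGroup D) η)
      (bandSpace D I u) := by
  refine ⟨fun γ => leftRegular_mem_bandSpace γ.1 hη, fun v hv => ?_⟩
  obtain ⟨⟨v, V⟩, ⟨hvV, hV⟩, rfl⟩ := hv
  rw [hasSum_norm_sq_iff (sq_nonneg _), ENNReal.ofReal_pow (norm_nonneg _), ofReal_norm]
  exact tsum_enorm_sq_inner_leftRegular ha hq hb hu hg hE hform hI hvV hV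

include ha hq hb hu hg hη hE hform in
theorem norm_eq_one_of_plancherelMeasure_eq
    (hμ : D.plancherelMeasure I =
      ENNReal.ofReal ((∏ k, a k) / |(invDiag q).det * (invDiag b).det|)) : ‖η‖ = 1 := by
  set M := ENNReal.ofReal ((∏ k, a k) / |(invDiag q).det * (invDiag b).det|) with hM
  have hM0 : M ≠ 0 := by
    have hdet := abs_pos.2 (mul_ne_zero (det_invDiag_ne_zero hq) (det_invDiag_ne_zero hb))
    exact (ENNReal.ofReal_pos.2 (div_pos (Finset.prod_pos fun k _ => ha k) hdet)).ne'
  have hMtop : M ≠ ∞ := ENNReal.ofReal_ne_top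
  have hfibre : ∀ᵐ l ∂D.plancherelMeasure, ‖E l‖ₑ ^ 2 = I.indicator (fun _ => M⁻¹) l := by
    filter_upwards [hE.mem_fieldSpace hη, hg, hform,
      D.ae_plancherelMeasure_iff.2 D.ae_mem_crossSection] with l hEl hgl hgen hl
    by_cases hlI : l ∈ I
    · rw [Set.indicator_of_mem hlI, hgen hlI, hM,
        enorm_sq_generatorFibre ha hl hu (hgl hlI) hq hb]
    · simp [hEl.2 hlI, hlI]
  have hI : NullMeasurableSet I D.plancherelMeasure := by
    have hsupp : MeasurableSet {l | ‖E l‖ₑ ^ 2 ≠ 0} :=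
      ((Lp.stronglyMeasurable E).enorm.pow_const 2) (measurableSet_singleton 0).compl
    refine hsupp.nullMeasurableSet.congr (Filter.eventuallyEq_set.2 ?_)
    filter_upwards [hfibre] with l hl
    simp only [hl, Set.indicator_apply_ne_zero, Set.mem_inter_iff,
      Function.mem_support, ENNReal.inv_ne_zero.2 hMtop, ne_eq, not_false_eq_true, and_true]
  have hsq : ‖η‖ₑ ^ 2 = 1 := by
    rw [← hE.enorm_eq, ← lintegral_enorm_sq_coeFn,
      lintegral_congr_ae hfibre, lintegral_indicator_const₀ hI, hμ,
      ENNReal.inv_mul_cancel hM0 hMtop]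
  rw [← ofReal_norm, ← ENNReal.ofReal_pow (norm_nonneg η), ENNReal.ofReal_eq_one] at hsq
  exact (pow_eq_one_iff_of_nonneg (norm_nonneg η) two_ne_zero).1 hsq

end Orbit

theorem bVec_pos {a : Fin p → ℝ} {I : Set (Fin p → ℝ)} (hI_ne : I.Nonempty)
    (hI : I ⊆ {l | l ∈ D.crossSection ∧ ∀ k, 0 ≤ l k ∧ l k ≤ a k}) (j : Fin d) :
    0 < bVec D I j := by
  obtain ⟨l, hl⟩ := hI_ne
  have hIcc : I ⊆ Set.Icc 0 a := fun l hl => ⟨fun k => ((hI hl).2 k).1, fun k => ((hI hl).2 k).2⟩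
  have hbdd : BddAbove ((fun l => |(D.B l).det|) '' I) :=
    (isCompact_Icc.bddAbove_image D.continuous_det_B.abs.continuousOn).mono (Set.image_mono hIcc)
  exact Real.rpow_pos_of_pos ((abs_pos.2 (hI hl).1).trans_le (le_csSup hbdd ⟨l, hl, rfl⟩)) _

end ExpGroup

end BandLimited

end

open BandLimited BandLimited.ExpGroup in
theorem mainTheorem3_general {p d : ℕ} {𝔫 : Type*} [LieRing 𝔫] [LieAlgebra ℝ 𝔫]
    (D : NilpotentAlgebra p d 𝔫)
    (a : Fin p → ℝ) (ha : ∀ k, 0 < a k) (q : Fin d → ℝ) (hq : ∀ j, q j ≠ 0)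
    (b : Fin d → ℝ) (hb : ∀ j, b j ≠ 0)
    (I : Set (Fin p → ℝ)) (c : Fin p → ℝ) (hI : I ⊆ Set.Icc c (c + a))
    (u : L2R d) (hu : ‖u‖ = 1)
    (g : (Fin p → ℝ) → L2R d)
    (hg : ∀ᵐ l ∂D.plancherelMeasure, l ∈ I →
      IsParsevalFrame (gaborSystem (g l) (invDiag b) (D.B l * invDiag q)) ⊤)
    (η : L2N D) (hη : η ∈ bandSpace D I u)
    (ηhat : DirectIntegral D) (hηhat : IsPlancherelTransform D η ηhat)
    (hform : ∀ᵐ l ∂D.plancherelMeasure, l ∈ I →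
      ηhat l = (((∏ k, √(a k)) * √|(D.B l).det| : ℝ) : ℂ)⁻¹ • tensor (g l) u) :
    IsParsevalFrame (fun γ : quasiLattice D a q b => leftRegular D (γ : ExpGroup D) η)
        (bandSpace D I u) ∧
      (D.plancherelMeasure I =
          ENNReal.ofReal ((∏ k, a k) / |(invDiag q).det * (invDiag b).det|) →
        IsONB (fun γ : quasiLattice D a q b => leftRegular D (γ : ExpGroup D) η)
          (bandSpace D I u)) := by
  have hframe := isParsevalFrame_leftRegular ha hq hb hu hg hη hηhat hform hI
  refine ⟨hframe, fun hμ => hframe.isONB (fun γ => ?_) (isClosed_bandSpace I hu)⟩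
  rw [LinearIsometry.norm_map]
  exact norm_eq_one_of_plancherelMeasure_eq ha hq hb hu hg hη hηhat hform hμ

open BandLimited BandLimited.ExpGroup in
theorem mainTheorem3 {p d : ℕ} (hd : 1 ≤ d) {𝔫 : Type*} [LieRing 𝔫] [LieAlgebra ℝ 𝔫]
    (D : NilpotentAlgebra p d 𝔫)
    (a : Fin p → ℝ) (ha : ∀ k, 0 < a k) (q : Fin d → ℝ) (hq : ∀ j, 0 < q j)
    (I : Set (Fin p → ℝ)) (hI_meas : MeasurableSet I) (hI_ne : I.Nonempty)
    (hI : I ⊆ {l | l ∈ D.crossSection ∧ ∀ k, 0 ≤ l k ∧ l k ≤ a k})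
    (u : L2R d) (hu : ‖u‖ = 1)
    (g : (Fin p → ℝ) → L2R d)
    (hg : ∀ᵐ l ∂D.plancherelMeasure, l ∈ I →
      IsParsevalFrame (gaborSystem (g l) (invDiag (bVec D I)) (D.B l * invDiag q)) ⊤)
    (η : L2N D) (hη : η ∈ bandSpace D I u)
    (ηhat : DirectIntegral D) (hηhat : IsPlancherelTransform D η ηhat)
    (hform : ∀ᵐ l ∂D.plancherelMeasure, l ∈ I →
      ηhat l = (((∏ k, √(a k)) * √|(D.B l).det| : ℝ) : ℂ)⁻¹ • tensor (g l) u) :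
    IsParsevalFrame
        (fun γ : quasiLattice D a q (bVec D I) => leftRegular D (γ : ExpGroup D) η)
        (bandSpace D I u) ∧
      (D.plancherelMeasure I =
          ENNReal.ofReal ((∏ k, a k) / |(invDiag q).det * (invDiag (bVec D I)).det|) →
        IsONB
          (fun γ : quasiLattice D a q (bVec D I) => leftRegular D (γ : ExpGroup D) η)
          (bandSpace D I u)) :=
  mainTheorem3_general D a ha q (fun j => (hq j).ne') _ (fun j => (bVec_pos hI_ne hI j).ne') I 0
    (fun _ hl => ⟨fun k => ((hI hl).2 k).1, fun k => by simpa using ((hI hl).2 k).2⟩)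
    u hu g hg η hη ηhat hηhat hform
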